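/- **Setting.** Let $k$ be a field of characteristic $\neq 2$, let $f\in k[x]$ be an irreducible polynomial of degree $n$, and let $L$ be the splitting field of $f$ over $k$. Assume that $L/k$ is Galois, with group $G=\mathrm{Gal}(L/k)$. Number the roots of $f$ in $L$ and regard $G$ as a subgroup of $S_n$ through its action on the roots. Let $d_f$ be the discriminant of $f$. Put $\mu_2=\{\pm1\}$. **Double covers.** Let $$1\to\mu_2\to\widetilde S_n^{+}\to S_n\to1\qquad\text{and}\qquad 1\to\mu_2\to\widetilde S_n^{-}\to S_n\to 1$$ be the positive and the negative double cover of $S_n$: transpositions lift to elements of order $2$ in $\widetilde S_n^{+}$ and to elements of order $4$ in $\widetilde S_n^{-}$, and products of two disjoint transpositions lift to elements of order $4$ in both. Concretely, $\widetilde S_n^{\pm}$ consists of the elements $x$ of the complex Clifford algebra with generators $e_1,\dots,e_n$ and relations $e_i^2=1$, $e_ie_j=-e_je_i$ $(i\ne j)$ which lie over some $\sigma\in S_n$ in the following sense: $x$ is even or odd as $\sigma$ is, $xe_i=\mathrm{sgn}(\sigma)\,e_{\sigma(i)}x$ for all $i$, and $x x^{t}=1$ for $\widetilde S_n^+$, respectively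 $xx^t=\mathrm{sgn}(\sigma)$ for $\widetilde S_n^-$, where $x\mapsto x^t$ is the reversal anti-automorphism. Let $\widetilde G^{\pm}$ be the restriction of $\widetilde S_n^{\pm}$ to $G$, i.e. the preimage of $G$. **The notation $G_1^{(4,\sigma_1)}$.** Let $\sigma_1,\dots,\sigma_r$ be generators of a group $G$ such that $\sigma_1$ has order $2$ and $H=\langle\sigma_2,\dots,\sigma_r\rangle$ is normal in $G$ and does not contain $\sigma_1$. For two extensions $G_1,G_2$ of $G$ by $\mu_2$ we write $G_2=G_1^{(4,\sigma_1)}$ if for all preimages $\tilde\sigma_j\in G_1$ of the $\sigma_j$ there are preimages $\bar\sigma_j\in G_2$ of the $\sigma_j$ such that 1. $\tilde\sigma_1$ has order $2$; 2. $\bar\sigma_1^{2}\in\mu_2$ and $\bar\sigma_1^2\neq1$; 3. all other relations are identical: for every word $w$ in $r-1$ letters and all integers $\alpha,l$, $$\tilde\sigma_j^{\alpha}=(-1)^l\,w(\tilde\sigma_2,\dots,\tilde\sigma_r)\iff\bar\sigma_j^{\alpha}=(-1)^l\,w(\bar\sigma_2,\dots,\bar\sigma_r)\qquad(j\ge2),$$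 $$[\tilde\sigma_i,\tilde\sigma_j]=(-1)^l\,w(\tilde\sigma_2,\dots,\tilde\sigma_r)\iff[\bar\sigma_i,\bar\sigma_j]=(-1)^l\,w(\bar\sigma_2,\dots,\bar\sigma_r)\qquad(i,j\ge1).$$ **Obstructions.** For an extension $\widetilde G$ of $G=\mathrm{Gal}(L/k)$ by $\mu_2$, the obstruction $O_{\widetilde G}\in\mathrm{Br}(k)$ of the embedding problem $(L/k,\widetilde G,\mu_2)$ is the class of the crossed product algebra $\bigoplus_{g\in G}Lu_g$ with $u_gx=g(x)u_g$ for $x\in L$ and $u_gu_h=c(g,h)u_{gh}$, where $c:G\times G\to\{\pm1\}$ is the $2$-cocycle $s(g)s(h)=c(g,h)s(gh)$ of any set-theoretic section $s$ of $\widetilde G\to G$. For $a,b\in k^\times$, $(a,b)\in\mathrm{Br}(k)$ is the class of the quaternion algebra with $i^2=a$, $j^2=b$, $ij=-ji$. **Statement.** Assume that $G$ contains a transposition. Then: 1. for every transposition $\sigma_1\in G$ and all generators $\sigma_2,\dots,\sigma_r$ of $H=G\cap A_n$, one has $\widetilde G^-=\widetilde G^{+(4,\sigma_1)}$; 2. $d_f\ne0$,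 and $$O_{\widetilde G^-}=(-1,d_f)\cdot O_{\widetilde G^+}\quad\text{in }\mathrm{Br}(k),$$ whichever sections are used to compute the two obstructions. -/

import Mathlib

open scoped TensorProduct
open Polynomial
universe u


namespace BrauerClass

section Tensor

variable {k A B : Type*} [Field k] [Ring A] [Ring B] [Algebra k A] [Algebra k B]

noncomputable def coefA {ι : Type*} (b : Module.Basis ι k B) (i : ι) : A ⊗[k] B →ₗ[k] A :=
  (TensorProduct.rid k A).toLinearMap ∘ₗ LinearMap.lTensor A (b.coord i)

theorem coefA_mul_left {ι : Type*} (b : Module.Basis ι k B) (i : ι) (x : A) (t : A ⊗[k] B) :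
    coefA b i ((x ⊗ₜ 1) * t) = x * coefA b i t := by
  induction t with
  | zero => simp
  | tmul a c => simp [coefA]
  | add p q hp hq => rw [mul_add, map_add, map_add, mul_add, hp, hq]

theorem coefA_mul_right {ι : Type*} (b : Module.Basis ι k B) (i : ι) (x : A) (t : A ⊗[k] B) :
    coefA b i (t * (x ⊗ₜ 1)) = coefA b i t * x := by
  induction t with
  | zero => simp
  | tmul a c => simp [coefA]
  | add p q hp hq => rw [add_mul, map_add, map_add, add_mul, hp, hq]

theorem sum_coefA {ι : Type*} [Fintype ι] (b : Module.Basis ι k B) (t : A ⊗[k] B) :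
    ∑ i, coefA b i t ⊗ₜ[k] b i = t := by
  induction t with
  | zero => simp
  | tmul a c =>
    conv_rhs => rw [← b.sum_repr c, TensorProduct.tmul_sum]
    simp [coefA, TensorProduct.smul_tmul']
  | add p q hp hq =>
    simp only [map_add, TensorProduct.add_tmul, Finset.sum_add_distrib, hp, hq]

theorem eq_one_tmul {ι : Type*} [Fintype ι] [Algebra.IsCentral k A] (b : Module.Basis ι k B)
    (t : A ⊗[k] B) (ht : ∀ a : A, (a ⊗ₜ 1) * t = t * (a ⊗ₜ 1)) : ∃ c : B, t = 1 ⊗ₜ c := by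
  have h : ∀ i, ∃ r : k, coefA b i t = algebraMap k A r := by
    intro i
    apply (Algebra.IsCentral.mem_center_iff k).1
    rw [Subalgebra.mem_center_iff]
    intro a
    rw [← coefA_mul_left, ht, coefA_mul_right]
  choose r hr using h
  refine ⟨∑ i, r i • b i, ?_⟩
  rw [← sum_coefA b t, TensorProduct.tmul_sum]
  refine Finset.sum_congr rfl fun i _ => ?_
  rw [hr, Algebra.algebraMap_eq_smul_one, TensorProduct.smul_tmul]

theorem isCentral_tensor [Nontrivial A] [Algebra.IsCentral k A] [Algebra.IsCentral k B]
    [FiniteDimensional k B] : Algebra.IsCentral k (A ⊗[k] B) where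
  out t ht := by
    rw [Subalgebra.mem_center_iff] at ht
    obtain ⟨c, rfl⟩ := eq_one_tmul (Module.finBasis k B) t fun a => ht _
    have hc : c ∈ Subalgebra.center k B := by
      rw [Subalgebra.mem_center_iff]
      intro b
      have := ht (1 ⊗ₜ b)
      simp only [Algebra.TensorProduct.tmul_mul_tmul, one_mul] at this
      exact Algebra.TensorProduct.includeRight_injective
        (FaithfulSMul.algebraMap_injective k A) this
    obtain ⟨r, rfl⟩ := (Algebra.IsCentral.mem_center_iff k).1 hc
    exact Algebra.mem_bot.2 ⟨r, by
      simp [Algebra.algebraMap_eq_smul_one, Algebra.TensorProduct.one_def]⟩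

theorem isSimpleRing_tensor [Algebra.IsCentral k A] [IsSimpleRing A] [IsSimpleRing B]
    [FiniteDimensional k B] : IsSimpleRing (A ⊗[k] B) := by
  classical
  have : Nontrivial (A ⊗[k] B) :=
    (Algebra.TensorProduct.includeRight_injective (A := A) (B := B) (R := k)
        (FaithfulSMul.algebraMap_injective k A)).nontrivial
  refine IsSimpleRing.of_eq_bot_or_eq_top fun I => or_iff_not_imp_left.2 fun hI => ?_
  let b := Module.finBasis k B
  let supp : A ⊗[k] B → Finset (Fin (Module.finrank k B)) := fun t =>
    Finset.univ.filter fun i => coefA b i t ≠ 0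
  have supp_zero : ∀ t, supp t = ∅ → t = 0 := by
    intro t ht
    rw [← sum_coefA b t]
    refine Finset.sum_eq_zero fun i _ => ?_
    have : coefA b i t = 0 := by
      by_contra h
      have : i ∈ supp t := by simp [supp, h]
      simp [ht] at this
    rw [this, TensorProduct.zero_tmul]
  have hex : ∃ m, ∃ t ∈ I, t ≠ 0 ∧ (supp t).card = m := by
    by_contra h
    push Not at h
    apply hI
    rw [eq_bot_iff]
    intro t ht
    by_contra h0
    exact h _ t ht (by simpa using h0) rfl
  obtain ⟨t, htI, ht0, htm⟩ := Nat.find_spec hex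
  have hmin : ∀ s ∈ I, (supp s).card < (supp t).card → s = 0 := by
    intro s hs hlt
    by_contra h0
    exact Nat.find_min hex (htm ▸ hlt) ⟨s, hs, h0, rfl⟩
  obtain ⟨i, hi⟩ : (supp t).Nonempty := by
    rw [Finset.nonempty_iff_ne_empty]
    exact fun h => ht0 (supp_zero t h)
  let J : TwoSidedIdeal A := TwoSidedIdeal.mk'
    {a | ∃ s ∈ I, supp s ⊆ supp t ∧ coefA b i s = a}
    ⟨0, I.zero_mem, by simp [supp], by simp⟩
    (by
      rintro _ _ ⟨s, hs, h1, rfl⟩ ⟨s', hs', h1', rfl⟩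
      refine ⟨s + s', I.add_mem hs hs', fun j hj => ?_, by simp⟩
      by_contra hjt
      have e1 : coefA b j s = 0 := by
        by_contra h
        exact hjt (h1 (by simp [supp, h]))
      have e2 : coefA b j s' = 0 := by
        by_contra h
        exact hjt (h1' (by simp [supp, h]))
      simp [supp, e1, e2] at hj)
    (by
      rintro _ ⟨s, hs, h1, rfl⟩
      refine ⟨-s, I.neg_mem hs, fun j hj => h1 ?_, by simp⟩
      simpa [supp] using hj)
    (by
      rintro x _ ⟨s, hs, h1, rfl⟩
      refine ⟨(x ⊗ₜ 1) * s, I.mul_mem_left _ _ hs, fun j hj => h1 ?_, coefA_mul_left ..⟩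
      simp only [supp, Finset.mem_filter, Finset.mem_univ, true_and, coefA_mul_left] at hj ⊢
      exact right_ne_zero_of_mul hj)
    (by
      rintro _ x ⟨s, hs, h1, rfl⟩
      refine ⟨s * (x ⊗ₜ 1), I.mul_mem_right _ _ hs, fun j hj => h1 ?_, coefA_mul_right ..⟩
      simp only [supp, Finset.mem_filter, Finset.mem_univ, true_and, coefA_mul_right] at hj ⊢
      exact left_ne_zero_of_mul hj)
  have h1 : (1 : A) ∈ J := by
    refine IsSimpleRing.one_mem_of_ne_zero_mem J (x := coefA b i t) ?_ ?_
    · simpa [supp] using hi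
    · exact (TwoSidedIdeal.mem_mk' ..).2 ⟨t, htI, subset_rfl, rfl⟩
  obtain ⟨s, hsI, hst, hs1⟩ := (TwoSidedIdeal.mem_mk' ..).1 h1
  have hcomm : ∀ a : A, (a ⊗ₜ 1) * s = s * (a ⊗ₜ 1) := by
    intro a
    rw [← sub_eq_zero]
    apply hmin _ (I.sub_mem (I.mul_mem_left _ _ hsI) (I.mul_mem_right _ _ hsI))
    apply Finset.card_lt_card
    refine ⟨fun j hj => hst ?_, fun h => ?_⟩
    · by_contra h
      have e : coefA b j s = 0 := by simpa [supp] using h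
      simp [supp, coefA_mul_left, coefA_mul_right, e] at hj
    · have := h hi
      simp [supp, coefA_mul_left, coefA_mul_right, hs1] at this
  obtain ⟨c, rfl⟩ := eq_one_tmul b s hcomm
  have hc : c ≠ 0 := by
    rintro rfl
    simp at hs1
  let K : TwoSidedIdeal B := I.comap (Algebra.TensorProduct.includeRight (R := k) (A := A) (B := B))
  have h1K : (1 : B) ∈ K := IsSimpleRing.one_mem_of_ne_zero_mem K hc (by
    simpa [K, TwoSidedIdeal.mem_comap] using hsI)
  rw [TwoSidedIdeal.mem_comap] at h1K
  rw [← TwoSidedIdeal.one_mem_iff]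
  simpa [Algebra.TensorProduct.one_def] using h1K

end Tensor

variable {k : Type u} [Field k]

/-- The tensor product of two finite-dimensional central simple algebras over a field. -/
noncomputable def tensorCSA (A B : CSA.{u, u} k) : CSA.{u, u} k where
  toAlgCat := AlgCat.of k (A ⊗[k] B)
  isCentral := isCentral_tensor (A := A) (B := B)
  isSimple := isSimpleRing_tensor (A := A) (B := B)
  fin_dim := inferInstanceAs (FiniteDimensional k (A ⊗[k] B))

theorem tensorCSA_congr (A A' B B' : CSA.{u, u} k) (hA : IsBrauerEquivalent A A')
    (hB : IsBrauerEquivalent B B') : IsBrauerEquivalent (tensorCSA A B) (tensorCSA A' B') := by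
  obtain ⟨n, n', hn, hn', ⟨e⟩⟩ := hA
  obtain ⟨m, m', hm, hm', ⟨e'⟩⟩ := hB
  refine ⟨n * m, n' * m', mul_ne_zero hn hm, mul_ne_zero hn' hm', ⟨?_⟩⟩
  exact (Matrix.reindexAlgEquiv k (A ⊗[k] B) finProdFinEquiv).symm.trans <|
    (Matrix.kroneckerTMulAlgEquiv (Fin n) (Fin m) k k A B).symm.trans <|
    (Algebra.TensorProduct.congr e e').trans <|
    (Matrix.kroneckerTMulAlgEquiv (Fin n') (Fin m') k k A' B').trans <|
    Matrix.reindexAlgEquiv k (A' ⊗[k] B') finProdFinEquiv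

/-- The multiplication of the Brauer group: the product of the classes of `A` and `B` is the
class of `A ⊗ B`. -/
noncomputable instance instMulBrauerGroup : Mul (BrauerGroup.{u, u} k) where
  mul := Quotient.map₂ tensorCSA fun _ _ hA _ _ hB => tensorCSA_congr _ _ _ _ hA hB

end BrauerClass

namespace BrauerClass
section Quaternion

variable {k : Type u} [Field k]

theorem quaternion_isCentral [NeZero (2 : k)] (a b : kˣ) :
    Algebra.IsCentral k (QuaternionAlgebra k (a : k) 0 (b : k)) where
  out q hq := by
    rw [Subalgebra.mem_center_iff] at hq
    have h2 : (2 : k) ≠ 0 := NeZero.ne 2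
    have hi := hq ⟨0, 1, 0, 0⟩
    have hj := hq ⟨0, 0, 1, 0⟩
    simp only [QuaternionAlgebra.ext_iff, QuaternionAlgebra.re_mul, QuaternionAlgebra.imI_mul,
      QuaternionAlgebra.imJ_mul, QuaternionAlgebra.imK_mul] at hi hj
    obtain ⟨-, -, h3, h4⟩ := hi
    obtain ⟨-, h6, -, h8⟩ := hj
    have hJ : q.imJ = 0 := by
      have : 2 * q.imJ = 0 := by linear_combination h4
      simpa [h2] using this
    have hI : q.imI = 0 := by
      have : 2 * q.imI = 0 := by linear_combination -h8
      simpa [h2] using this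
    have hK : q.imK = 0 := by
      have : 2 * (a : k) * q.imK = 0 := by linear_combination h3
      simpa [h2] using this
    refine Algebra.mem_bot.2 ⟨q.re, ?_⟩
    ext <;> simp [hI, hJ, hK]

theorem quaternion_isSimple [NeZero (2 : k)] (a b : kˣ) :
    IsSimpleRing (QuaternionAlgebra k (a : k) 0 (b : k)) := by
  have h2 : (2 : k) ≠ 0 := NeZero.ne 2
  refine IsSimpleRing.of_eq_bot_or_eq_top fun I => or_iff_not_imp_left.2 fun hI => ?_
  obtain ⟨q, hq, hq0⟩ : ∃ q ∈ I, q ≠ 0 := by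
    by_contra h
    push Not at h
    exact hI (eq_bot_iff.2 fun q hq => by simpa using h q hq)
  let i : QuaternionAlgebra k (a : k) 0 (b : k) := ⟨0, 1, 0, 0⟩
  let j : QuaternionAlgebra k (a : k) 0 (b : k) := ⟨0, 0, 1, 0⟩
  have scal : ∀ r : k, (⟨r, 0, 0, 0⟩ : QuaternionAlgebra k (a : k) 0 (b : k)) ∈ I → r ≠ 0 →
      I = ⊤ := by
    intro r hr h0
    rw [← TwoSidedIdeal.one_mem_iff]
    convert I.mul_mem_left ⟨r⁻¹, 0, 0, 0⟩ _ hr using 1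
    ext <;> simp [h0]
  have sel : ∀ s ∈ I, s.re ≠ 0 → I = ⊤ := by
    intro s hs h0
    have e1 : (2 * (a : k)) • s.re = (2 * a * s.re : k) := rfl
    have m1 := I.add_mem (I.mul_mem_left ⟨a, 0, 0, 0⟩ _ hs)
      (I.mul_mem_right _ i (I.mul_mem_left i _ hs))
    have m2 := I.add_mem (I.mul_mem_left ⟨b, 0, 0, 0⟩ _ m1)
      (I.mul_mem_right _ j (I.mul_mem_left j _ m1))
    refine scal (4 * a * b * s.re) ?_ ?_
    · convert m2 using 1
      ext <;> simp [i, j] <;> ring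
    · have h4 : (4 : k) ≠ 0 := by
        have : (4 : k) = 2 * 2 := by norm_num
        rw [this]
        exact mul_ne_zero h2 h2
      simp [h4, h0]
  by_cases h0 : q.re = 0
  · by_cases h1 : q.imI = 0
    · by_cases h3 : q.imJ = 0
      · have h4 : q.imK ≠ 0 := by
          intro h4
          exact hq0 (by ext <;> simp [h0, h1, h3, h4])
        refine sel _ (I.mul_mem_left j _ (I.mul_mem_left i _ hq)) ?_
        simp [i, j, h4]
      · refine sel _ (I.mul_mem_left j _ hq) ?_
        simp [j, h3]
    · refine sel _ (I.mul_mem_left i _ hq) ?_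
      simp [i, h1]
  · exact sel q hq h0

/-- The class `(a, b)` of the quaternion algebra with generators `i`, `j` and relations
`i² = a`, `j² = b`, `ij = -ji`. -/
noncomputable def quaternionClass [NeZero (2 : k)] (a b : kˣ) : BrauerGroup.{u, u} k :=
  Quotient.mk (Brauer.CSA_Setoid k)
    { toAlgCat := AlgCat.of k (QuaternionAlgebra k (a : k) 0 (b : k))
      isCentral := quaternion_isCentral a b
      isSimple := quaternion_isSimple a b
      fin_dim := inferInstanceAs (FiniteDimensional k (QuaternionAlgebra k (a : k) 0 (b : k))) }

end Quaternion
end BrauerClass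

set_option linter.unusedSectionVars false
namespace BrauerClass
section Crossed

set_option linter.unusedSectionVars false

/-- The (not necessarily normalised) `2`-cocycles of `Gal(L/k)` with values in `Lˣ`. -/
abbrev TwoCocycle (k L : Type*) [Field k] [Field L] [Algebra k L] : Type _ :=
  {c : Gal(L/k) × Gal(L/k) → Lˣ // groupCohomology.IsMulCocycle₂ c}

variable {k L : Type u} [Field k] [Field L] [Algebra k L] [FiniteDimensional k L]

/-- The crossed product algebra of a `2`-cocycle `c`: the `L`-vector space with basis `u_g`,
`g ∈ Gal(L/k)`, with the multiplication determined by `u_g x = g(x) u_g` and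
`u_g u_h = c(g, h) u_{gh}`. The element `∑ x_g u_g` is represented by its coordinates. -/
@[ext] structure CrossedProduct (c : TwoCocycle k L) where
  coord : Gal(L/k) → L

namespace CrossedProduct

variable {c : TwoCocycle k L}

instance : Zero (CrossedProduct c) := ⟨⟨0⟩⟩
instance : Add (CrossedProduct c) := ⟨fun a b => ⟨a.coord + b.coord⟩⟩
instance : Neg (CrossedProduct c) := ⟨fun a => ⟨-a.coord⟩⟩
instance : Sub (CrossedProduct c) := ⟨fun a b => ⟨a.coord - b.coord⟩⟩
instance {R : Type*} [SMul R L] : SMul R (CrossedProduct c) := ⟨fun r a => ⟨r • a.coord⟩⟩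

theorem coord_injective : Function.Injective (coord : CrossedProduct c → Gal(L/k) → L) :=
  fun _ _ h => CrossedProduct.ext h

instance : AddCommGroup (CrossedProduct c) :=
  coord_injective.addCommGroup coord rfl (fun _ _ => rfl) (fun _ => rfl) (fun _ _ => rfl)
    (fun _ _ => rfl) (fun _ _ => rfl)

@[simp] theorem coord_zero (g : Gal(L/k)) : (0 : CrossedProduct c).coord g = 0 := rfl
@[simp] theorem coord_add (a b : CrossedProduct c) (g : Gal(L/k)) :
    (a + b).coord g = a.coord g + b.coord g := rfl
@[simp] theorem coord_neg (a : CrossedProduct c) (g : Gal(L/k)) :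
    (-a).coord g = -a.coord g := rfl
@[simp] theorem coord_sub (a b : CrossedProduct c) (g : Gal(L/k)) :
    (a - b).coord g = a.coord g - b.coord g := rfl
@[simp] theorem coord_smul {R : Type*} [SMul R L] (r : R) (a : CrossedProduct c) (g : Gal(L/k)) :
    (r • a).coord g = r • a.coord g := rfl

/-- The coordinates as an additive map. -/
def coordHom : CrossedProduct c →+ (Gal(L/k) → L) where
  toFun := coord
  map_zero' := rfl
  map_add' _ _ := rfl

instance : Module k (CrossedProduct c) :=
  coord_injective.module k coordHom fun _ _ => rfl

/-- The coordinate of index `g` of a product is the sum, over the ways to write `g = h (h⁻¹ g)`,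
of the coefficients of `(x_h u_h) (y_{h⁻¹g} u_{h⁻¹g})`. -/
noncomputable instance : Mul (CrossedProduct c) :=
  ⟨fun a b => ⟨fun g => ∑ h : Gal(L/k),
    a.coord h * h (b.coord (h⁻¹ * g)) * (c.1 (h, h⁻¹ * g) : L)⟩⟩

theorem coord_mul (a b : CrossedProduct c) (g : Gal(L/k)) :
    (a * b).coord g = ∑ h : Gal(L/k),
      a.coord h * h (b.coord (h⁻¹ * g)) * (c.1 (h, h⁻¹ * g) : L) := rfl

open Classical in
/-- The element `x u_g`. -/
noncomputable def single (c : TwoCocycle k L) (g : Gal(L/k)) (x : L) : CrossedProduct c :=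
  ⟨Pi.single g x⟩

noncomputable instance : One (CrossedProduct c) := ⟨single c 1 ((c.1 (1, 1))⁻¹ : Lˣ)⟩

theorem one_def : (1 : CrossedProduct c) = single c 1 ((c.1 (1, 1))⁻¹ : Lˣ) := rfl

theorem coord_single_same (g : Gal(L/k)) (x : L) : (single c g x).coord g = x := by
  simp [single]

theorem coord_single_ne {g h : Gal(L/k)} (hgh : h ≠ g) (x : L) : (single c g x).coord h = 0 := by
  simp [single, hgh]

theorem coord_single_mul (g h : Gal(L/k)) (x : L) (b : CrossedProduct c) :
    (single c g x * b).coord h = x * g (b.coord (g⁻¹ * h)) * (c.1 (g, g⁻¹ * h) : L) := by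
  rw [coord_mul, Finset.sum_eq_single g]
  · rw [coord_single_same]
  · intro h' _ hne
    rw [coord_single_ne hne, zero_mul, zero_mul]
  · simp

theorem coord_mul_single (g h : Gal(L/k)) (x : L) (b : CrossedProduct c) :
    (b * single c g x).coord h =
      b.coord (h * g⁻¹) * (h * g⁻¹) x * (c.1 (h * g⁻¹, g) : L) := by
  rw [coord_mul, Finset.sum_eq_single (h * g⁻¹)]
  · have : (h * g⁻¹)⁻¹ * h = g := by group
    rw [this, coord_single_same]
  · intro h' _ hne
    rw [coord_single_ne, map_zero, mul_zero, zero_mul]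
    rintro rfl
    exact hne (by group)
  · simp

theorem single_mul_single (g h : Gal(L/k)) (x y : L) :
    single c g x * single c h y = single c (g * h) (x * g y * (c.1 (g, h) : L)) := by
  ext e
  rw [coord_single_mul]
  by_cases he : e = g * h
  · subst he
    rw [inv_mul_cancel_left, coord_single_same, coord_single_same]
  · rw [coord_single_ne he, coord_single_ne, map_zero, mul_zero, zero_mul]
    rintro rfl
    exact he (by group)

theorem single_add (g : Gal(L/k)) (x y : L) :
    single c g (x + y) = single c g x + single c g y := by
  classical
  ext e
  by_cases he : e = g
  · subst he; simp [coord_single_same]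
  · simp [coord_single_ne he]

theorem induction_on {P : CrossedProduct c → Prop} (a : CrossedProduct c) (h0 : P 0)
    (hs : ∀ g x, P (single c g x)) (ha : ∀ a b, P a → P b → P (a + b)) : P a := by
  classical
  have key : ∀ s : Finset Gal(L/k), P ⟨∑ g ∈ s, Pi.single g (a.coord g)⟩ := by
    intro s
    induction s using Finset.induction_on with
    | empty => exact h0
    | insert g s hg ih =>
      rw [Finset.sum_insert hg]
      have h := ha _ _ (hs g (a.coord g)) ih
      have e : single c g (a.coord g) + ⟨∑ g ∈ s, Pi.single g (a.coord g)⟩ =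
          ⟨Pi.single g (a.coord g) + ∑ g ∈ s, Pi.single g (a.coord g)⟩ := by
        ext j
        by_cases hj : j = g
        · subst hj
          rw [coord_add, coord_single_same]
          simp
        · rw [coord_add, coord_single_ne hj]
          simp [hj]
      rwa [e] at h
  have h := key Finset.univ
  rwa [Finset.univ_sum_single] at h

theorem left_distrib' (a b d : CrossedProduct c) : a * (b + d) = a * b + a * d := by
  ext g
  simp only [coord_mul, coord_add, map_add, mul_add, add_mul, Finset.sum_add_distrib]

theorem right_distrib' (a b d : CrossedProduct c) : (a + b) * d = a * d + b * d := by
  ext g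
  simp only [coord_mul, coord_add, add_mul, Finset.sum_add_distrib]

theorem zero_mul' (a : CrossedProduct c) : 0 * a = 0 := by
  ext g
  simp [coord_mul]

theorem mul_zero' (a : CrossedProduct c) : a * 0 = 0 := by
  ext g
  simp [coord_mul]

theorem cocycle_val (g h j : Gal(L/k)) :
    (c.1 (g * h, j) : L) * c.1 (g, h) = g (c.1 (h, j) : L) * c.1 (g, h * j) := by
  have := congrArg (Units.val) (c.2 g h j)
  simpa using this

theorem mul_assoc' (a b d : CrossedProduct c) : a * b * d = a * (b * d) := by
  induction a using induction_on with
  | h0 => simp [zero_mul']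
  | ha a a' h h' => rw [right_distrib', right_distrib', right_distrib', h, h']
  | hs g x =>
    induction b using induction_on with
    | h0 => simp [zero_mul', mul_zero']
    | ha a a' h h' => rw [right_distrib', left_distrib', right_distrib', left_distrib', h, h']
    | hs h y =>
      induction d using induction_on with
      | h0 => simp [mul_zero']
      | ha a a' h h' => rw [left_distrib', left_distrib', left_distrib', h, h']
      | hs j z =>
        simp only [single_mul_single, mul_assoc, map_mul, AlgEquiv.mul_apply]
        congr 2
        have := cocycle_val (c := c) g h j
        linear_combination (g y * g (h z)) * this

theorem coord_unit_mul (x : L) (b : CrossedProduct c) (h : Gal(L/k)) :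
    (single c 1 x * b).coord h = x * b.coord h * (c.1 (1, 1) : L) := by
  rw [coord_single_mul, inv_one, one_mul, AlgEquiv.one_apply,
    groupCohomology.map_one_fst_of_isMulCocycle₂ c.2 h]

theorem coord_mul_unit (x : L) (b : CrossedProduct c) (h : Gal(L/k)) :
    (b * single c 1 x).coord h = b.coord h * h (x * (c.1 (1, 1) : L)) := by
  rw [coord_mul_single, inv_one, mul_one,
    groupCohomology.map_one_snd_of_isMulCocycle₂ c.2 h, map_mul, mul_assoc]
  rfl

theorem one_mul' (a : CrossedProduct c) : 1 * a = a := by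
  ext g
  rw [one_def, coord_unit_mul, mul_right_comm, Units.inv_mul, one_mul]

theorem mul_one' (a : CrossedProduct c) : a * 1 = a := by
  ext g
  rw [one_def, coord_mul_unit, Units.inv_mul, map_one, mul_one]

noncomputable instance : Ring (CrossedProduct c) where
  mul_assoc := mul_assoc'
  one_mul := one_mul'
  mul_one := mul_one'
  left_distrib := left_distrib'
  right_distrib := right_distrib'
  zero_mul := zero_mul'
  mul_zero := mul_zero'
  neg_add_cancel := neg_add_cancel
  zsmul := fun n a => n • a
  zsmul_zero' := fun a => SubNegMonoid.zsmul_zero' a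
  zsmul_succ' := fun n a => SubNegMonoid.zsmul_succ' n a
  zsmul_neg' := fun n a => SubNegMonoid.zsmul_neg' n a
  sub_eq_add_neg := sub_eq_add_neg
  nsmul := fun n a => n • a
  nsmul_zero := fun a => AddMonoid.nsmul_zero a
  nsmul_succ := fun n a => AddMonoid.nsmul_succ n a

noncomputable instance : Algebra k (CrossedProduct c) :=
  Algebra.ofModule
    (fun r a b => by
      ext g
      simp [coord_mul, Finset.smul_sum])
    (fun r a b => by
      ext g
      simp [coord_mul, Finset.smul_sum])

instance : FiniteDimensional k (CrossedProduct c) :=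
  FiniteDimensional.of_injective (V₂ := Gal(L/k) → L)
    { toFun := coord, map_add' := fun _ _ => rfl, map_smul' := fun _ _ => rfl } coord_injective

instance : Nontrivial (CrossedProduct c) :=
  ⟨⟨0, 1, fun h => by
    have := congrArg (fun a : CrossedProduct c => a.coord 1) h
    rw [one_def] at this
    simp only [coord_single_same, coord_zero] at this
    exact Units.ne_zero _ this.symm⟩⟩

theorem single_isUnit (g : Gal(L/k)) {x : L} (hx : x ≠ 0) :
    ∃ b, b * single c g x = (1 : CrossedProduct c) := by
  refine ⟨single c g⁻¹ ((g⁻¹ x)⁻¹ * ((c.1 (g⁻¹, g))⁻¹ : Lˣ) * ((c.1 (1, 1))⁻¹ : Lˣ)), ?_⟩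
  rw [single_mul_single, one_def, inv_mul_cancel]
  congr 1
  have : g⁻¹ x ≠ 0 := by simpa using hx
  field_simp
  simp

theorem isCentral [IsGalois k L] (c : TwoCocycle k L) : Algebra.IsCentral k (CrossedProduct c) where
  out a ha := by
    rw [Subalgebra.mem_center_iff] at ha
    have hx : ∀ (g : Gal(L/k)) (x : L), x * a.coord g = a.coord g * g x := by
      intro g x
      have h := congrArg (fun a : CrossedProduct c => a.coord g)
        (ha (single c 1 (x * ((c.1 (1, 1))⁻¹ : Lˣ))))
      simp only [coord_unit_mul, coord_mul_unit] at h
      rwa [mul_right_comm, Units.inv_mul_cancel_right] at h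
    have h1 : ∀ g : Gal(L/k), g ≠ 1 → a.coord g = 0 := by
      intro g hg
      by_contra h0
      apply hg
      ext x
      apply mul_left_cancel₀ h0
      rw [AlgEquiv.one_apply, ← hx, mul_comm]
    have h2 : ∀ g : Gal(L/k), g (a.coord 1 * c.1 (1, 1)) = a.coord 1 * c.1 (1, 1) := by
      intro g
      have h := congrArg (fun a : CrossedProduct c => a.coord g) (ha (single c g 1))
      simp only [coord_single_mul, coord_mul_single, inv_mul_cancel, mul_inv_cancel, one_mul,
        AlgEquiv.one_apply, mul_one] at h
      rw [groupCohomology.map_one_fst_of_isMulCocycle₂ c.2 g,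
        groupCohomology.map_one_snd_of_isMulCocycle₂ c.2 g] at h
      rw [map_mul]
      exact h
    obtain ⟨r, hr⟩ := (IsGalois.mem_range_algebraMap_iff_fixed (F := k) (E := L) _).2 h2
    refine Algebra.mem_bot.2 ⟨r, ?_⟩
    ext g
    rw [Algebra.algebraMap_eq_smul_one, coord_smul, one_def]
    by_cases hg : g = 1
    · subst hg
      rw [coord_single_same, Algebra.smul_def, hr]
      simp
    · rw [coord_single_ne hg, h1 g hg, smul_zero]

theorem isSimple (c : TwoCocycle k L) : IsSimpleRing (CrossedProduct c) := by
  classical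
  refine IsSimpleRing.of_eq_bot_or_eq_top fun I => or_iff_not_imp_left.2 fun hI => ?_
  obtain ⟨a, ha, ha0⟩ : ∃ a ∈ I, a ≠ 0 := by
    by_contra h
    push Not at h
    exact hI (eq_bot_iff.2 fun q hq => by simpa using h q hq)
  let supp : CrossedProduct c → Finset Gal(L/k) := fun a => Finset.univ.filter fun g => a.coord g ≠ 0
  have key : ∀ (n : ℕ) (a : CrossedProduct c), a ∈ I → a ≠ 0 → (supp a).card = n → I = ⊤ := by
    intro n
    induction n using Nat.strong_induction_on with
    | _ n ih =>
      intro a ha ha0 hn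
      obtain ⟨g, hg⟩ : ∃ g, a.coord g ≠ 0 := by
        by_contra h
        push Not at h
        exact ha0 (by ext g; simpa using h g)
      by_cases huniq : ∀ h, h ≠ g → a.coord h = 0
      · have : a = single c g (a.coord g) := by
          ext h
          by_cases hh : h = g
          · subst hh; rw [coord_single_same]
          · rw [huniq h hh, coord_single_ne hh]
        obtain ⟨b, hb⟩ := single_isUnit (c := c) g hg
        rw [← TwoSidedIdeal.one_mem_iff, ← hb, ← this]
        exact I.mul_mem_left _ _ ha
      · push Not at huniq
        obtain ⟨h, hne, hh⟩ := huniq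
        obtain ⟨x, hx⟩ : ∃ x, h x ≠ g x := by
          by_contra H
          push Not at H
          exact hne (AlgEquiv.ext H)
        let y : L := x * ((c.1 (1, 1))⁻¹ : Lˣ)
        let a' : CrossedProduct c :=
          single c 1 (g x * ((c.1 (1, 1))⁻¹ : Lˣ)) * a - a * single c 1 y
        have hc' : ∀ e, a'.coord e = (g x - e x) * a.coord e := by
          intro e
          simp only [a', y, coord_sub, coord_unit_mul, coord_mul_unit]
          rw [mul_right_comm, Units.inv_mul_cancel_right, Units.inv_mul_cancel_right]
          ring
        refine ih _ ?_ a' (I.sub_mem (I.mul_mem_left _ _ ha) (I.mul_mem_right _ _ ha)) ?_ rfl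
        · rw [← hn]
          refine Finset.card_lt_card ⟨fun e he => ?_, fun H => ?_⟩
          · simp only [supp, Finset.mem_filter, Finset.mem_univ, true_and, hc'] at he ⊢
            exact right_ne_zero_of_mul he
          · have := H (show g ∈ supp a by simpa [supp] using hg)
            simp [supp, hc'] at this
        · intro h0
          have := congrArg (fun a : CrossedProduct c => a.coord h) h0
          simp only [hc', coord_zero, mul_eq_zero, hh, or_false] at this
          exact hx (sub_eq_zero.1 this).symm
  exact key _ a ha ha0 rfl

end CrossedProduct

/-- The Brauer class of the crossed product algebra of a `2`-cocycle. -/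
noncomputable def crossedProductClass [IsGalois k L] (c : TwoCocycle k L) :
    BrauerGroup.{u, u} k :=
  Quotient.mk (Brauer.CSA_Setoid k)
    { toAlgCat := AlgCat.of k (CrossedProduct c)
      isCentral := CrossedProduct.isCentral c
      isSimple := CrossedProduct.isSimple c
      fin_dim := inferInstanceAs (FiniteDimensional k (CrossedProduct c)) }

end Crossed
end BrauerClass

namespace EmbeddingProblem
section Ext

variable {N E G G' : Type*} [Group N] [Group E] [Group G] [Group G']

/-- The fibre product `E ×_G G'` of the projection of an extension and a homomorphism `ρ`. -/
def pullbackGroup (S : GroupExtension N E G) (ρ : G' →* G) : Subgroup (E × G') :=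
  (S.rightHom.comp (MonoidHom.fst E G')).eqLocus (ρ.comp (MonoidHom.snd E G'))

/-- The pullback of a group extension of `G` by `N` along `ρ : G' → G`. If `ρ` is injective, this
is the restriction of the extension to the subgroup `G' ⊆ G`. -/
def pullback (S : GroupExtension N E G) (ρ : G' →* G) :
    GroupExtension N (pullbackGroup S ρ) G' where
  inl := (S.inl.prod (1 : N →* G')).codRestrict _ fun n => by
    change S.rightHom (S.inl n) = ρ 1
    simp
  rightHom := (MonoidHom.snd E G').comp (pullbackGroup S ρ).subtype
  inl_injective a b h := S.inl_injective (congrArg (fun x => x.1.1) h)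
  range_inl_eq_ker_rightHom := by
    ext ⟨⟨x, g⟩, hx⟩
    have hx' : S.rightHom x = ρ g := hx
    simp only [MonoidHom.mem_range, MonoidHom.mem_ker]
    constructor
    · rintro ⟨n, hn⟩
      exact (congrArg (fun x => x.1.2) hn).symm
    · intro hg
      have hg' : g = 1 := hg
      subst hg'
      rw [map_one, ← MonoidHom.mem_ker, ← S.range_inl_eq_ker_rightHom] at hx'
      obtain ⟨n, rfl⟩ := hx'
      exact ⟨n, rfl⟩
  rightHom_surjective g := by
    obtain ⟨x, hx⟩ := S.rightHom_surjective (ρ g)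
    exact ⟨⟨(x, g), hx⟩, rfl⟩

/-- The factor set of a section `s` of an extension: the function `c` determined by
`s(g) s(h) = c(g, h) s(gh)`. -/
noncomputable def factorSet (S : GroupExtension N E G) (s : S.Section) (p : G × G) : N :=
  (MonoidHom.ofInjective S.inl_injective).symm
    ⟨s p.1 * s p.2 * (s (p.1 * p.2))⁻¹, by
      rw [S.range_inl_eq_ker_rightHom, MonoidHom.mem_ker]
      simp⟩

theorem inl_factorSet (S : GroupExtension N E G) (s : S.Section) (g h : G) :
    S.inl (factorSet S s (g, h)) * s (g * h) = s g * s h := by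
  rw [factorSet, MonoidHom.apply_ofInjective_symm]
  simp

theorem inl_central (S : GroupExtension ℤˣ E G) (a : ℤˣ) (x : E) :
    x * S.inl a = S.inl a * x := by
  rcases Int.units_eq_one_or a with rfl | rfl
  · simp
  · rw [← mul_inv_eq_iff_eq_mul, ← S.inl_conjAct_comm]
    rcases Int.units_eq_one_or (S.conjAct x (-1)) with h | h
    · rw [map_eq_one_iff _ (MulEquiv.injective _)] at h
      exact absurd h (by decide)
    · rw [h]

theorem factorSet_cocycle (S : GroupExtension ℤˣ E G) (s : S.Section) (g h j : G) :
    factorSet S s (g * h, j) * factorSet S s (g, h) =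
      factorSet S s (h, j) * factorSet S s (g, h * j) := by
  apply S.inl_injective
  apply mul_right_cancel (b := s (g * h * j))
  have e1 := inl_factorSet S s (g * h) j
  have e2 := inl_factorSet S s g h
  have e3 := inl_factorSet S s h j
  have e4 := inl_factorSet S s g (h * j)
  calc S.inl (factorSet S s (g * h, j) * factorSet S s (g, h)) * s (g * h * j)
      = S.inl (factorSet S s (g, h)) * (S.inl (factorSet S s (g * h, j)) * s (g * h * j)) := by
        rw [mul_comm (factorSet S s (g * h, j)), map_mul, mul_assoc]
    _ = s g * (s h * s j) := by rw [e1, ← mul_assoc, e2, mul_assoc]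
    _ = S.inl (factorSet S s (h, j)) * (S.inl (factorSet S s (g, h * j)) * s (g * (h * j))) := by
        rw [← e3, ← mul_assoc, inl_central, mul_assoc, e4]
    _ = S.inl (factorSet S s (h, j) * factorSet S s (g, h * j)) * s (g * h * j) := by
        rw [mul_assoc g h j, map_mul S.inl, mul_assoc]

end Ext
end EmbeddingProblem

namespace DoubleCover
open CliffordAlgebra

/-- The quadratic form `x₁² + ⋯ + xₙ²` on `ℂⁿ`. -/
noncomputable abbrev sumSq (n : ℕ) : QuadraticForm ℂ (Fin n → ℂ) :=
  QuadraticMap.weightedSumSquares ℂ (fun _ : Fin n => (1 : ℂ))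

/-- The complex Clifford algebra on generators `e₁, …, eₙ` with `eᵢ² = 1`, `eᵢeⱼ = -eⱼeᵢ`. -/
abbrev Cl (n : ℕ) : Type := CliffordAlgebra (sumSq n)

/-- The generator `eᵢ` of the Clifford algebra. -/
noncomputable def gen {n : ℕ} (i : Fin n) : Cl n := ι (sumSq n) (Pi.single i 1)

/-- The sign of a permutation, as a complex number. -/
def csign {n : ℕ} (σ : Equiv.Perm (Fin n)) : ℂ := ((Equiv.Perm.sign σ : ℤ) : ℂ)

theorem csign_mul {n : ℕ} (σ τ : Equiv.Perm (Fin n)) : csign (σ * τ) = csign σ * csign τ := by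
  simp [csign]

theorem csign_mul_self {n : ℕ} (σ : Equiv.Perm (Fin n)) : csign σ * csign σ = 1 := by
  rcases Int.units_eq_one_or (Equiv.Perm.sign σ) with h | h <;> simp [csign, h]

theorem gen_mul_self {n : ℕ} (i : Fin n) : gen i * gen i = (1 : Cl n) := by
  rw [gen, ι_sq_scalar]
  simp [QuadraticMap.weightedSumSquares_apply, Pi.single_apply]

theorem gen_mul_gen {n : ℕ} {i j : Fin n} (h : i ≠ j) : gen i * gen j = -(gen j * gen i : Cl n) := by
  rw [gen, gen]
  apply ι_mul_ι_comm_of_isOrtho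
  rw [QuadraticMap.isOrtho_def]
  simp only [QuadraticMap.weightedSumSquares_apply, Pi.add_apply, one_smul,
    ← Finset.sum_add_distrib]
  refine Finset.sum_congr rfl fun k _ => ?_
  by_cases h1 : k = i
  · subst h1; simp [h]
  · simp [h1]

/-- The conditions that say that `x` is an element of the Pin group which lies over the
permutation `σ` of the orthonormal basis `e₁, …, eₙ`, with spinor norm `χ(σ)`: `x` is even or odd
as `σ` is, its twisted conjugation sends each `eᵢ` to `e_{σ(i)}`, and `x x^t = χ(σ)`. -/
structure IsPinLift {n : ℕ} (χ : Equiv.Perm (Fin n) →* ℤˣ) (x : Cl n)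
    (σ : Equiv.Perm (Fin n)) : Prop where
  parity : involute x = csign σ • x
  conj : ∀ i, x * gen i = csign σ • (gen (σ i) * x)
  norm : x * reverse x = algebraMap ℂ (Cl n) ((χ σ : ℤ) : ℂ)

variable {n : ℕ} {χ : Equiv.Perm (Fin n) →* ℤˣ}

theorem IsPinLift.mul {x y : Cl n} {σ τ : Equiv.Perm (Fin n)} (hx : IsPinLift χ x σ)
    (hy : IsPinLift χ y τ) : IsPinLift χ (x * y) (σ * τ) where
  parity := by
    rw [map_mul, hx.parity, hy.parity, csign_mul, smul_mul_smul_comm]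
  conj i := by
    rw [mul_assoc, hy.conj, mul_smul_comm, ← mul_assoc, hx.conj, smul_mul_assoc, smul_smul,
      csign_mul, mul_comm (csign σ), mul_assoc, Equiv.Perm.mul_apply]
  norm := by
    rw [reverse.map_mul, mul_assoc, ← mul_assoc y, hy.norm, Algebra.commutes, ← mul_assoc,
      hx.norm, ← map_mul]
    simp

theorem IsPinLift.one : IsPinLift χ (1 : Cl n) 1 where
  parity := by simp [csign]
  conj i := by simp [csign]
  norm := by simp

theorem IsPinLift.isUnit {x : Cl n} {σ : Equiv.Perm (Fin n)} (hx : IsPinLift χ x σ) :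
    ∃ y, x * y = 1 ∧ ((χ σ : ℤ) : ℂ) • reverse x = y := by
  refine ⟨_, ?_, rfl⟩
  rw [mul_smul_comm, hx.norm, Algebra.algebraMap_eq_smul_one, smul_smul]
  rcases Int.units_eq_one_or (χ σ) with h | h <;> simp [h]

theorem IsPinLift.inv {x : (Cl n)ˣ} {σ : Equiv.Perm (Fin n)} (hx : IsPinLift χ (x : Cl n) σ) :
    IsPinLift χ ((x⁻¹ : (Cl n)ˣ) : Cl n) σ⁻¹ := by
  have hs : csign σ⁻¹ = csign σ := by simp [csign]
  have hinv : ((x⁻¹ : (Cl n)ˣ) : Cl n) = ((χ σ : ℤ) : ℂ) • reverse (x : Cl n) := by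
    obtain ⟨y, hy, hy'⟩ := hx.isUnit
    rw [hy', ← Units.inv_mul_cancel_left x y, hy, mul_one]
  refine ⟨?_, fun i => ?_, ?_⟩
  · rw [hs, hinv, map_smul, ← reverse_involute, hx.parity, map_smul, smul_comm]
  · have h := hx.conj (σ⁻¹ i)
    rw [hs]
    rw [← Equiv.Perm.mul_apply, mul_inv_cancel, Equiv.Perm.one_apply] at h
    have h' : gen i * (x : Cl n) = csign σ • ((x : Cl n) * gen (σ⁻¹ i)) := by
      rw [h, smul_smul, csign_mul_self, one_smul]
    have := congrArg (fun z => ((x⁻¹ : (Cl n)ˣ) : Cl n) * z * ((x⁻¹ : (Cl n)ˣ) : Cl n)) h'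
    simpa [mul_assoc] using this
  · have h1 : reverse ((x⁻¹ : (Cl n)ˣ) : Cl n) = ((χ σ : ℤ) : ℂ) • (x : Cl n) := by
      rw [hinv, map_smul, reverse_reverse]
    rw [h1, mul_smul_comm, Units.inv_mul, Algebra.algebraMap_eq_smul_one, map_inv,
      Int.units_inv_eq_self]

/-- The subgroup of the pairs `(x, σ)` in `Cl(n)ˣ × Sₙ` with `x` a lift of `σ` to the Pin group
with spinor norm given by `χ`. -/
noncomputable def group (χ : Equiv.Perm (Fin n) →* ℤˣ) :
    Subgroup ((Cl n)ˣ × Equiv.Perm (Fin n)) where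
  carrier := {p | IsPinLift χ (p.1 : Cl n) p.2}
  mul_mem' ha hb := ha.mul hb
  one_mem' := IsPinLift.one
  inv_mem' ha := ha.inv

/-- `±1` as units of the Clifford algebra. -/
noncomputable def unitHom (n : ℕ) : ℤˣ →* (Cl n)ˣ := Units.map (Int.castRingHom (Cl n)).toMonoidHom

theorem nontrivial_cl : Nontrivial (Cl n) :=
  letI : Invertible (2 : ℂ) := invertibleOfNonzero two_ne_zero
  inferInstanceAs (Nontrivial (CliffordAlgebra (sumSq n)))

theorem algebraMap_injective : Function.Injective (algebraMap ℂ (Cl n)) :=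
  haveI : Nontrivial (Cl n) := nontrivial_cl
  (algebraMap ℂ (Cl n)).injective

theorem two_ne_zero_cl : (2 : Cl n) ≠ 0 := by
  rw [show (2 : Cl n) = algebraMap ℂ (Cl n) 2 from (map_ofNat _ 2).symm]
  rw [Ne, map_eq_zero_iff _ algebraMap_injective]
  exact two_ne_zero

theorem one_ne_neg_one : (1 : Cl n) ≠ -1 := by
  intro h
  apply two_ne_zero_cl (n := n)
  have : (1 : Cl n) + 1 = 0 := by nth_rewrite 2 [h]; simp
  rw [← one_add_one_eq_two, this]

/-- The subalgebra generated by the `eᵢ` with `i ∈ s`. -/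
noncomputable def sub (s : Finset (Fin n)) : Subalgebra ℂ (Cl n) :=
  Algebra.adjoin ℂ (gen '' (s : Set (Fin n)))

theorem sub_univ : sub (Finset.univ : Finset (Fin n)) = ⊤ := by
  rw [eq_top_iff, ← adjoin_range_ι, sub]
  refine Algebra.adjoin_le ?_
  rintro _ ⟨v, rfl⟩
  have : v = ∑ i, v i • (Pi.single i 1 : Fin n → ℂ) := by
    ext j
    simp [Pi.single_apply]
  rw [this, map_sum]
  refine Subalgebra.sum_mem _ fun i _ => ?_
  rw [map_smul]
  have hi : gen i ∈ Algebra.adjoin ℂ (gen '' ((Finset.univ : Finset (Fin n)) : Set (Fin n))) :=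
    Algebra.subset_adjoin ⟨i, by simp, rfl⟩
  exact Subalgebra.smul_mem _ hi _

theorem involute_mem_sub {s : Finset (Fin n)} {a : Cl n} (ha : a ∈ sub s) : involute a ∈ sub s := by
  induction ha using Algebra.adjoin_induction with
  | mem x hx =>
    obtain ⟨i, hi, rfl⟩ := hx
    rw [gen, involute_ι]
    exact neg_mem (Algebra.subset_adjoin ⟨i, hi, rfl⟩)
  | algebraMap r => rw [AlgHom.commutes]; exact Subalgebra.algebraMap_mem _ _
  | add x y _ _ hx hy => rw [map_add]; exact add_mem hx hy
  | mul x y _ _ hx hy => rw [map_mul]; exact mul_mem hx hy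

theorem gen_mul_sub {s : Finset (Fin n)} {j : Fin n} (hj : j ∉ s) {a : Cl n} (ha : a ∈ sub s) :
    gen j * a = involute a * gen j := by
  induction ha using Algebra.adjoin_induction with
  | mem x hx =>
    obtain ⟨i, hi, rfl⟩ := hx
    rw [gen_mul_gen (by rintro rfl; exact hj hi)]
    simp [gen]
  | algebraMap r => rw [AlgHom.commutes, Algebra.commutes]
  | add x y _ _ hx hy => rw [map_add, mul_add, add_mul, hx, hy]
  | mul x y _ _ hx hy => rw [map_mul, ← mul_assoc, hx, mul_assoc, hy, mul_assoc]

theorem mem_sub_insert {s : Finset (Fin n)} {j : Fin n} (hj : j ∉ s) {x : Cl n}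
    (hx : x ∈ sub (insert j s)) : ∃ a ∈ sub s, ∃ b ∈ sub s, x = a + b * gen j := by
  induction hx using Algebra.adjoin_induction with
  | mem x hx =>
    obtain ⟨i, hi, rfl⟩ := hx
    rw [Finset.coe_insert] at hi
    rcases hi with rfl | hi
    · exact ⟨0, zero_mem _, 1, one_mem _, by simp⟩
    · exact ⟨gen i, Algebra.subset_adjoin ⟨i, hi, rfl⟩, 0, zero_mem _, by simp⟩
  | algebraMap r => exact ⟨_, Subalgebra.algebraMap_mem _ r, 0, zero_mem _, by simp⟩
  | add x y _ _ hx hy =>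
    obtain ⟨a, ha, b, hb, rfl⟩ := hx
    obtain ⟨a', ha', b', hb', rfl⟩ := hy
    exact ⟨a + a', add_mem ha ha', b + b', add_mem hb hb', by noncomm_ring⟩
  | mul x y _ _ hx hy =>
    obtain ⟨a, ha, b, hb, rfl⟩ := hx
    obtain ⟨a', ha', b', hb', rfl⟩ := hy
    refine ⟨a * a' + b * involute b', add_mem (mul_mem ha ha') (mul_mem hb (involute_mem_sub hb')),
      a * b' + b * involute a', add_mem (mul_mem ha hb') (mul_mem hb (involute_mem_sub ha')), ?_⟩
    have e1 := gen_mul_sub hj ha'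
    have e2 := gen_mul_sub hj hb'
    calc (a + b * gen j) * (a' + b' * gen j)
        = a * a' + a * b' * gen j + b * (gen j * a') + b * (gen j * b') * gen j := by noncomm_ring
      _ = a * a' + a * b' * gen j + b * involute a' * gen j
          + b * involute b' * (gen j * gen j) := by rw [e1, e2]; noncomm_ring
      _ = _ := by rw [gen_mul_self]; noncomm_ring

theorem scalar_of_commute {x : Cl n} (hx : involute x = x) (h : ∀ i, x * gen i = gen i * x) :
    ∃ r : ℂ, x = algebraMap ℂ (Cl n) r := by
  have key : ∀ t s : Finset (Fin n), x ∈ sub (t ∪ s) → x ∈ sub s := by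
    intro t
    induction t using Finset.induction_on with
    | empty => intro s hs; simpa using hs
    | insert j t _ ih =>
      intro s hs
      by_cases hjs : j ∈ t ∪ s
      · apply ih
        rwa [Finset.insert_union, Finset.insert_eq_of_mem hjs] at hs
      · rw [Finset.insert_union] at hs
        obtain ⟨a, ha, b, hb, hab⟩ := mem_sub_insert hjs hs
        apply ih
        have e1 := gen_mul_sub hjs ha
        have e2 := gen_mul_sub hjs hb
        have e3 : gen j * x * gen j = x := by rw [← h, mul_assoc, gen_mul_self, mul_one]
        have e4 : gen j * x * gen j = involute a + involute b * gen j := by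
          rw [hab, mul_add, ← mul_assoc, e1, e2, add_mul, mul_assoc, mul_assoc _ (gen j) (gen j),
            gen_mul_self, mul_one, mul_one]
        have e5 : involute x = involute a - involute b * gen j := by
          rw [hab, map_add, map_mul]
          simp [gen, sub_eq_add_neg]
        have e6 : (2 : ℂ) • x = (2 : ℂ) • involute a := by
          have h1 : x = involute a + involute b * gen j := e3.symm.trans e4
          have h2 : x = involute a - involute b * gen j := hx.symm.trans e5
          calc (2 : ℂ) • x = x + x := two_smul _ _
            _ = (involute a + involute b * gen j) + (involute a - involute b * gen j) :=
              congrArg₂ (· + ·) h1 h2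
            _ = (2 : ℂ) • involute a := by rw [two_smul]; abel
        have e7 : x = involute a := by
          have := congrArg (fun z => (2 : ℂ)⁻¹ • z) e6
          simpa [smul_smul] using this
        rw [e7]
        exact involute_mem_sub ha
  have hx0 : x ∈ sub (∅ : Finset (Fin n)) := by
    apply key Finset.univ
    rw [Finset.union_empty, sub_univ]
    exact Algebra.mem_top
  simp only [sub, Finset.coe_empty, Set.image_empty, Algebra.adjoin_empty] at hx0
  obtain ⟨r, hr⟩ := Algebra.mem_bot.1 hx0
  exact ⟨r, hr.symm⟩

theorem eq_one_or_neg_one {x : Cl n} (hx : IsPinLift χ x 1) : x = 1 ∨ x = -1 := by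
  obtain ⟨r, rfl⟩ := scalar_of_commute (x := x) (by simpa [csign] using hx.parity)
    (fun i => by simpa [csign] using hx.conj i)
  have h := hx.norm
  rw [reverse.commutes, ← map_mul, map_one, Units.val_one, Int.cast_one] at h
  have h' := algebraMap_injective h
  rcases mul_self_eq_one_iff.1 h' with rfl | rfl <;> simp

/-- The lift `η (eᵢ - eⱼ) / √2` of the transposition `(i j)`. -/
noncomputable def swapLift (η : ℂ) (i j : Fin n) : Cl n := (η * ((√2 : ℝ) : ℂ)⁻¹) • (gen i - gen j)

theorem swapLift_mul_self (η : ℂ) {i j : Fin n} (h : i ≠ j) :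
    swapLift η i j * swapLift η i j = algebraMap ℂ (Cl n) (η * η) := by
  have h2 : ((√2 : ℝ) : ℂ)⁻¹ * ((√2 : ℝ) : ℂ)⁻¹ = 2⁻¹ := by
    rw [← mul_inv, ← Complex.ofReal_mul, Real.mul_self_sqrt (by norm_num)]
    norm_num
  have e : (gen i - gen j) * (gen i - gen j) = (2 : ℂ) • (1 : Cl n) := by
    have h' := gen_mul_gen h
    calc (gen i - gen j) * (gen i - gen j) =
        gen i * gen i + gen j * gen j - gen i * gen j - gen j * gen i := by noncomm_ring
      _ = _ := by rw [gen_mul_self, gen_mul_self, h', two_smul]; abel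
  rw [swapLift, smul_mul_smul_comm, e, smul_smul, Algebra.algebraMap_eq_smul_one]
  congr 1
  linear_combination (2 * η * η) * h2

theorem csign_swap {i j : Fin n} (h : i ≠ j) : csign (Equiv.swap i j) = -1 := by
  simp [csign, Equiv.Perm.sign_swap h]

theorem isPinLift_swap {η : ℂ} {i j : Fin n} (h : i ≠ j)
    (hη : η * η = ((χ (Equiv.swap i j) : ℤ) : ℂ)) :
    IsPinLift χ (swapLift η i j) (Equiv.swap i j) where
  parity := by
    rw [csign_swap h, swapLift, map_smul, map_sub]
    simp only [gen, involute_ι, neg_smul, one_smul]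
    rw [← smul_neg]
    congr 1
    abel
  conj k := by
    rw [csign_swap h, swapLift, smul_mul_assoc, mul_smul_comm, smul_comm]
    congr 1
    rw [neg_smul, one_smul, sub_mul, mul_sub]
    by_cases h1 : k = i
    · subst h1
      rw [Equiv.swap_apply_left, gen_mul_self, gen_mul_self]
      abel
    · by_cases h2 : k = j
      · subst h2
        rw [Equiv.swap_apply_right, gen_mul_self, gen_mul_self]
        abel
      · rw [Equiv.swap_apply_of_ne_of_ne h1 h2, gen_mul_gen h1, gen_mul_gen h2]
        abel
  norm := by
    have : reverse (swapLift η i j) = swapLift η i j := by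
      simp [swapLift, gen]
    rw [this, swapLift_mul_self _ h, hη]

theorem exists_isPinLift (χ : Equiv.Perm (Fin n) →* ℤˣ) (σ : Equiv.Perm (Fin n)) :
    ∃ x : (Cl n)ˣ, IsPinLift χ (x : Cl n) σ := by
  induction σ using Equiv.Perm.swap_induction_on with
  | one => exact ⟨1, IsPinLift.one⟩
  | swap_mul τ i j h ih =>
    obtain ⟨y, hy⟩ := ih
    obtain ⟨η, hη⟩ := IsAlgClosed.exists_pow_nat_eq (((χ (Equiv.swap i j) : ℤ) : ℂ)) two_pos
    rw [sq] at hη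
    have hs := swapLift_mul_self η h
    have hl := isPinLift_swap (χ := χ) h hη
    have h1 : η * η * (η * η) = 1 := by
      rw [hη]
      rcases Int.units_eq_one_or (χ (Equiv.swap i j)) with h | h <;> simp [h]
    have hu : swapLift η i j * ((η * η) • swapLift η i j) = 1 := by
      rw [mul_smul_comm, hs, Algebra.algebraMap_eq_smul_one, smul_smul, h1, one_smul]
    have hu' : ((η * η) • swapLift η i j) * swapLift η i j = 1 := by
      rw [smul_mul_assoc, hs, Algebra.algebraMap_eq_smul_one, smul_smul, h1, one_smul]
    exact ⟨⟨_, _, hu, hu'⟩ * y, hl.mul hy⟩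

theorem isPinLift_unitHom (a : ℤˣ) : IsPinLift χ ((unitHom n a : (Cl n)ˣ) : Cl n) 1 := by
  rcases Int.units_eq_one_or a with rfl | rfl
  · rw [map_one]; exact IsPinLift.one
  · have : ((unitHom n (-1) : (Cl n)ˣ) : Cl n) = -1 := by simp [unitHom]
    rw [this]
    exact ⟨by simp [csign], fun i => by simp [csign], by simp⟩

/-- The extension of `Sₙ` by `μ₂ = {±1}` formed by the lifts of the permutations of `e₁, …, eₙ` to
the Pin group, with spinor norm `χ`. -/
noncomputable def ext (χ : Equiv.Perm (Fin n) →* ℤˣ) :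
    GroupExtension ℤˣ (group χ) (Equiv.Perm (Fin n)) where
  inl := ((unitHom n).prod (1 : ℤˣ →* Equiv.Perm (Fin n))).codRestrict _
    fun a => isPinLift_unitHom a
  rightHom := (MonoidHom.snd _ _).comp (group χ).subtype
  inl_injective := by
    rw [injective_iff_map_eq_one]
    intro a ha
    rcases Int.units_eq_one_or a with rfl | rfl
    · rfl
    · have h1 : ((unitHom n (-1) : (Cl n)ˣ) : Cl n) = 1 :=
        congrArg (fun x => ((x.1.1 : (Cl n)ˣ) : Cl n)) ha
      simp only [unitHom, RingHom.toMonoidHom_eq_coe, Units.coe_map, MonoidHom.coe_coe,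
        Units.val_neg, Units.val_one, map_neg, map_one] at h1
      exact absurd h1.symm one_ne_neg_one
  range_inl_eq_ker_rightHom := by
    ext ⟨⟨x, σ⟩, hx⟩
    have hx' : IsPinLift χ (x : Cl n) σ := hx
    simp only [MonoidHom.mem_range, MonoidHom.mem_ker]
    constructor
    · rintro ⟨a, ha⟩
      exact (congrArg (fun x => x.1.2) ha).symm
    · intro hσ
      have hσ' : σ = 1 := hσ
      subst hσ'
      rcases eq_one_or_neg_one hx' with h | h
      · refine ⟨1, Subtype.ext (Prod.ext (Units.ext ?_) rfl)⟩
        simpa using h.symm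
      · refine ⟨-1, Subtype.ext (Prod.ext (Units.ext ?_) rfl)⟩
        simpa [unitHom] using h.symm
  rightHom_surjective σ := by
    obtain ⟨x, hx⟩ := exists_isPinLift χ σ
    exact ⟨⟨(x, σ), hx⟩, rfl⟩

end DoubleCover

namespace DoubleCover

section Orders

open CliffordAlgebra

variable {n : ℕ} {χ : Equiv.Perm (Fin n) →* ℤˣ}

/-- The unit of the Clifford algebra formed by the lift `η (eᵢ - eⱼ) / √2`. -/
noncomputable def swapUnit (η : ℂ) {i j : Fin n} (h : i ≠ j) (h1 : η * η * (η * η) = 1) :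
    (Cl n)ˣ where
  val := swapLift η i j
  inv := (η * η) • swapLift η i j
  val_inv := by
    rw [mul_smul_comm, swapLift_mul_self η h, Algebra.algebraMap_eq_smul_one, smul_smul, h1,
      one_smul]
  inv_val := by
    rw [smul_mul_assoc, swapLift_mul_self η h, Algebra.algebraMap_eq_smul_one, smul_smul, h1,
      one_smul]

theorem sq_eq_sq_of_rightHom_eq {x y : group χ} (h : (ext χ).rightHom x = (ext χ).rightHom y) :
    x ^ 2 = y ^ 2 := by
  have hk : x * y⁻¹ ∈ (ext χ).rightHom.ker := by
    rw [MonoidHom.mem_ker, map_mul, map_inv, h, mul_inv_cancel]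
  rw [← (ext χ).range_inl_eq_ker_rightHom] at hk
  obtain ⟨a, ha⟩ := hk
  have hx : x = (ext χ).inl a * y := by rw [ha, inv_mul_cancel_right]
  have hc : Commute ((ext χ).inl a) y := (EmbeddingProblem.inl_central (ext χ) a y).symm
  rw [hx, hc.mul_pow, ← map_pow, Int.units_sq, map_one, one_mul]

theorem exists_root (a : ℤˣ) : ∃ η : ℂ, η * η = ((a : ℤ) : ℂ) ∧ η * η * (η * η) = 1 := by
  obtain ⟨η, hη⟩ := IsAlgClosed.exists_pow_nat_eq (((a : ℤ) : ℂ)) two_pos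
  rw [sq] at hη
  refine ⟨η, hη, ?_⟩
  rw [hη]
  rcases Int.units_eq_one_or a with h | h <;> simp [h]

theorem lift_swap_sq {i j : Fin n} (h : i ≠ j) (x : group χ)
    (hx : (ext χ).rightHom x = Equiv.swap i j) :
    x ^ 2 = (ext χ).inl (χ (Equiv.swap i j)) := by
  obtain ⟨η, hη, h1⟩ := exists_root (χ (Equiv.swap i j))
  let y : group χ := ⟨(swapUnit η h h1, Equiv.swap i j), isPinLift_swap h hη⟩
  rw [sq_eq_sq_of_rightHom_eq (show (ext χ).rightHom x = (ext χ).rightHom y from hx), sq]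
  refine Subtype.ext (Prod.ext (Units.ext ?_) (Equiv.swap_mul_self i j))
  change swapLift η i j * swapLift η i j =
    ((unitHom n (χ (Equiv.swap i j)) : (Cl n)ˣ) : Cl n)
  rw [swapLift_mul_self η h, hη]
  simp [unitHom]

theorem lift_mul_swap_sq {i j k l : Fin n} (hij : i ≠ j) (hkl : k ≠ l) (hik : i ≠ k) (hil : i ≠ l)
    (hjk : j ≠ k) (hjl : j ≠ l) (x : group χ)
    (hx : (ext χ).rightHom x = Equiv.swap i j * Equiv.swap k l) :
    x ^ 2 = (ext χ).inl (-(χ (Equiv.swap i j) * χ (Equiv.swap k l))) := by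
  obtain ⟨η, hη, h1⟩ := exists_root (χ (Equiv.swap i j))
  obtain ⟨θ, hθ, h2⟩ := exists_root (χ (Equiv.swap k l))
  let y : group χ := ⟨(swapUnit η hij h1, Equiv.swap i j), isPinLift_swap hij hη⟩
  let z : group χ := ⟨(swapUnit θ hkl h2, Equiv.swap k l), isPinLift_swap hkl hθ⟩
  have hz := lift_swap_sq hkl z rfl
  have hy := lift_swap_sq hij y rfl
  have hzy : z * y = (ext χ).inl (-1) * (y * z) := by
    refine Subtype.ext (Prod.ext (Units.ext ?_) ?_)
    · change swapLift θ k l * swapLift η i j =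
        ((unitHom n (-1) : (Cl n)ˣ) : Cl n) * (swapLift η i j * swapLift θ k l)
      have e : (gen k - gen l) * (gen i - gen j) = -((gen i - gen j) * (gen k - gen l) : Cl n) := by
        have e1 := gen_mul_gen hik
        have e2 := gen_mul_gen hil
        have e3 := gen_mul_gen hjk
        have e4 := gen_mul_gen hjl
        simp only [mul_sub, sub_mul, e1, e2, e3, e4]
        abel
      simp only [unitHom, swapLift, smul_mul_smul_comm, e, mul_comm (η * _)]
      simp
    · have hd : (Equiv.swap k l).Disjoint (Equiv.swap i j) := by
        intro m
        by_cases h : m = k ∨ m = l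
        · right
          rcases h with rfl | rfl
          · exact Equiv.swap_apply_of_ne_of_ne hik.symm hjk.symm
          · exact Equiv.swap_apply_of_ne_of_ne hil.symm hjl.symm
        · push Not at h
          left
          exact Equiv.swap_apply_of_ne_of_ne h.1 h.2
      change Equiv.swap k l * Equiv.swap i j = 1 * (Equiv.swap i j * Equiv.swap k l)
      rw [one_mul, hd.commute.eq]
  rw [sq_eq_sq_of_rightHom_eq (show (ext χ).rightHom x = (ext χ).rightHom (y * z) from hx)]
  calc (y * z) ^ 2 = y * (z * y) * z := by rw [sq]; group
    _ = (ext χ).inl (-1) * (y ^ 2 * z ^ 2) := by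
      rw [hzy, ← mul_assoc, EmbeddingProblem.inl_central, sq, sq]
      group
    _ = _ := by rw [hy, hz, ← map_mul, ← map_mul, neg_one_mul]

theorem orderOf_eq_two {x : group χ} (h1 : (ext χ).rightHom x ≠ 1) (h2 : x ^ 2 = 1) :
    orderOf x = 2 :=
  orderOf_eq_prime h2 (by rintro rfl; exact h1 (map_one _))

theorem orderOf_eq_four {x : group χ} (h2 : x ^ 2 = (ext χ).inl (-1)) : orderOf x = 4 := by
  have : orderOf x = 2 ^ (1 + 1) := by
    apply orderOf_eq_prime_pow
    · rw [pow_one, h2, map_eq_one_iff _ (ext χ).inl_injective]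
      decide
    · rw [pow_succ, pow_one, pow_mul, h2, ← map_pow]
      simp
  simpa using this

end Orders

/-- The group of the positive double cover of `Sₙ`. -/
abbrev PosGroup (n : ℕ) : Type := group (1 : Equiv.Perm (Fin n) →* ℤˣ)

/-- The group of the negative double cover of `Sₙ`. -/
abbrev NegGroup (n : ℕ) : Type := group (Equiv.Perm.sign : Equiv.Perm (Fin n) →* ℤˣ)

/-- The positive double cover of `Sₙ`: transpositions lift to elements of order `2`, products of
two disjoint transpositions to elements of order `4`, as proved below. -/
noncomputable def pos (n : ℕ) : GroupExtension ℤˣ (PosGroup n) (Equiv.Perm (Fin n)) := ext 1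

/-- The negative double cover of `Sₙ`: transpositions lift to elements of order `4`, and so do
products of two disjoint transpositions, as proved below. -/
noncomputable def neg (n : ℕ) : GroupExtension ℤˣ (NegGroup n) (Equiv.Perm (Fin n)) :=
  ext Equiv.Perm.sign

theorem orderOf_pos_of_isSwap {n : ℕ} (x : PosGroup n) (hx : ((pos n).rightHom x).IsSwap) :
    orderOf x = 2 := by
  obtain ⟨i, j, h, e⟩ := hx
  have h2 := lift_swap_sq h x e
  refine orderOf_eq_two (fun h1 => h ?_) (by simpa using h2)
  exact Equiv.swap_eq_one_iff.1 (e.symm.trans h1)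

theorem orderOf_neg_of_isSwap {n : ℕ} (x : NegGroup n) (hx : ((neg n).rightHom x).IsSwap) :
    orderOf x = 4 := by
  obtain ⟨i, j, h, e⟩ := hx
  apply orderOf_eq_four
  rw [lift_swap_sq h x e, Equiv.Perm.sign_swap h]

theorem orderOf_pos_of_disjoint_swaps {n : ℕ} {i j k l : Fin n} (hij : i ≠ j) (hkl : k ≠ l)
    (hik : i ≠ k) (hil : i ≠ l) (hjk : j ≠ k) (hjl : j ≠ l) (x : PosGroup n)
    (hx : (pos n).rightHom x = Equiv.swap i j * Equiv.swap k l) : orderOf x = 4 := by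
  apply orderOf_eq_four
  rw [lift_mul_swap_sq hij hkl hik hil hjk hjl x hx]
  simp

theorem orderOf_neg_of_disjoint_swaps {n : ℕ} {i j k l : Fin n} (hij : i ≠ j) (hkl : k ≠ l)
    (hik : i ≠ k) (hil : i ≠ l) (hjk : j ≠ k) (hjl : j ≠ l) (x : NegGroup n)
    (hx : (neg n).rightHom x = Equiv.swap i j * Equiv.swap k l) : orderOf x = 4 := by
  apply orderOf_eq_four
  rw [lift_mul_swap_sq hij hkl hik hil hjk hjl x hx, Equiv.Perm.sign_swap hij,
    Equiv.Perm.sign_swap hkl]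
  simp

end DoubleCover

namespace EmbeddingProblem

/-- Let `S₁` and `S₂` be extensions of `G` by a group `N` that is generated by `ζ` of order `p`,
and let `σ₁ = σ 0, σ 1, …, σ m` be generators of `G` such that `σ₁` has order `p^(n-1)`, the
subgroup `H` generated by the other ones is normal, and no `σ₁^i` with `1 ≤ i < p^(n-1)` lies in
`H`. Then `S₂` is said to be `S₁^(p^n, σ₁)` if, for preimages `x j` of the `σ j` in `S₁` and suitable
preimages `y j` in `S₂`, the order of `x 0` is `p^(n-1)`, the element `(y 0)^(p^(n-1))` lies in `N`
and is not `1`, and all other relations between the generators are identical: the relations that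
express, up to a power of `ζ`, a power of a generator other than the first one, or a
commutator of two generators, through the generators other than the first one. The right sides
of these relations are arbitrary words `w` in the generators other than the first one, such as
`σ₂^β₂ ⋯ σₖ^βₖ`. -/
structure IsTwist (p n : ℕ) {N E₁ E₂ G : Type*} [Group N] [Group E₁] [Group E₂] [Group G]
    (ζ : N) (S₁ : GroupExtension N E₁ G) (S₂ : GroupExtension N E₂ G) {m : ℕ}
    (σ : Fin (m + 1) → G) : Prop where
  one_lt : 1 < n
  orderOf_zeta : orderOf ζ = p
  generates_kernel : Subgroup.zpowers ζ = ⊤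
  orderOf_first : orderOf (σ 0) = p ^ (n - 1)
  generates : Subgroup.closure (Set.range σ) = ⊤
  normal : (Subgroup.closure (Set.range fun j : Fin m => σ j.succ)).Normal
  notMem : ∀ i : ℕ, 1 ≤ i → i < p ^ (n - 1) →
    σ 0 ^ i ∉ Subgroup.closure (Set.range fun j : Fin m => σ j.succ)
  relations : ∀ x : Fin (m + 1) → E₁, (∀ j, S₁.rightHom (x j) = σ j) →
    ∃ y : Fin (m + 1) → E₂, (∀ j, S₂.rightHom (y j) = σ j) ∧
      orderOf (x 0) = p ^ (n - 1) ∧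
      y 0 ^ p ^ (n - 1) ∈ S₂.inl.range ∧ y 0 ^ p ^ (n - 1) ≠ 1 ∧
      (∀ (j : Fin m) (α l : ℤ) (w : FreeGroup (Fin m)),
        x j.succ ^ α = S₁.inl (ζ ^ l) * FreeGroup.lift (fun i => x i.succ) w ↔
          y j.succ ^ α = S₂.inl (ζ ^ l) * FreeGroup.lift (fun i => y i.succ) w) ∧
      (∀ (i j : Fin (m + 1)) (l : ℤ) (w : FreeGroup (Fin m)),
        x i * x j * (x i)⁻¹ * (x j)⁻¹ = S₁.inl (ζ ^ l) * FreeGroup.lift (fun i => x i.succ) w ↔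
          y i * y j * (y i)⁻¹ * (y j)⁻¹ = S₂.inl (ζ ^ l) * FreeGroup.lift (fun i => y i.succ) w)

/-- The action of the Galois group on the numbered roots of `f`, as a homomorphism to `Sₙ`. -/
noncomputable def rootPerm {k L : Type*} [Field k] [Field L] [Algebra k L] {n : ℕ} (f : k[X])
    (e : Fin n ≃ f.rootSet L) : Gal(L/k) →* Equiv.Perm (Fin n) where
  toFun g := (e.trans (g.toEquiv.subtypeEquiv fun a => by
    simp [Polynomial.mem_rootSet, Polynomial.aeval_algEquiv])).trans e.symm
  map_one' := by ext i; simp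
  map_mul' g h := by
    ext i
    simp

section Obstruction

variable {k L E : Type*} [Field k] [Field L] [Algebra k L] [Group E]

/-- The factor set of a section of an extension of `Gal(L/k)` by `μ₂ = {±1}`, as a `2`-cocycle with
values in `Lˣ`. -/
noncomputable def cocycle (S : GroupExtension ℤˣ E Gal(L/k)) (s : S.Section) :
    BrauerClass.TwoCocycle k L :=
  ⟨fun p => Units.map (Int.castRingHom L).toMonoidHom (factorSet S s p), fun g h j => by
    have e : g • Units.map (Int.castRingHom L).toMonoidHom (factorSet S s (h, j)) =
        Units.map (Int.castRingHom L).toMonoidHom (factorSet S s (h, j)) := by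
      ext
      simp
    rw [e, ← map_mul, ← map_mul, factorSet_cocycle]⟩

end Obstruction

/-- The obstruction to the embedding problem given by the Galois extension `L/k` and an extension
of `Gal(L/k)` by `μ₂ = {±1}`: the Brauer class of the crossed product algebra of a `2`-cocycle of
the extension. The cocycle is the factor set of the section `s`. -/
noncomputable def obstruction {k L : Type u} {E : Type*} [Field k] [Field L] [Algebra k L]
    [FiniteDimensional k L] [IsGalois k L] [Group E] (S : GroupExtension ℤˣ E Gal(L/k))
    (s : S.Section) : BrauerGroup.{u, u} k :=
  BrauerClass.crossedProductClass (cocycle S s)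

end EmbeddingProblem

/-!
The two double covers of `Sₙ` differ by a square root of the sign character: if `x` lifts `σ` to the
positive cover, then `η(σ) x`, with `η(σ) = 1` for even and `η(σ) = √-1` for odd `σ`, lifts `σ` to
the negative cover (`DoubleCover.posToNeg`). Since `η(σ) η(τ) = ± η(στ)` with the sign `-1` exactly
if `σ` and `τ` are both odd, this bijection is multiplicative up to the `2`-cocycle
`b(σ, τ) = signPairing (sgn σ) (sgn τ)` (`EmbeddingProblem.IsSignTwist`). It is a homomorphism on
the even part, it respects commutators because `η` is central and `b` symmetric, and the square of
a lift of a transposition changes its sign; this is all that the twist relation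
`IsSignTwist.isTwist` asks for.

For the Brauer classes, the Vandermonde product of the roots, times a power of the leading
coefficient, is a square root `δ ∈ L` of the discriminant `d` on which `Gal(L/k)` acts through the
sign (`exists_sqrt_discr`). Let `A` and `A'` be the crossed products of the positive and the
negative cover, and let `J`, `K` be `2 × 2` matrices with `J² = -1`, `K² = 1`, `KJ = -JK`. Since
the cocycles of `A` and `A'` differ by `b` up to a coboundary `∂ε`, there is a homomorphism `A →
A' ⊗ M₂(k)` which is the inclusion on `L` and maps `u_g` to `ε(g) u_g ⊗ 1` or `ε(g) u_g ⊗ J`, as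
`g` is even or odd. Its image commutes with `1 ⊗ J` and `δ ⊗ K`, which generate a quaternion
algebra `(-1, d)`. This gives `(-1, d) ⊗ A → A' ⊗ M₂(k)`, which is an isomorphism because the
source is simple and the dimensions agree (`crossedProductClass_eq_quaternionClass_mul`).
-/

/-! ### The discriminant as a product over the roots -/

namespace Polynomial

theorem derivative_prod_X_sub_C_eval {R ι : Type*} [CommRing R] [DecidableEq ι] (s : Finset ι)
    (r : ι → R) {i : ι} (hi : i ∈ s) :
    (derivative (∏ j ∈ s, (X - C (r j)))).eval (r i) = ∏ j ∈ s.erase i, (r i - r j) := by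
  rw [derivative_prod_finset, eval_finsetSum, Finset.sum_eq_single_of_mem i hi]
  · simp [eval_prod]
  · intro j _ hji
    have : i ∈ s.erase j := Finset.mem_erase.2 ⟨hji.symm, hi⟩
    simp [eval_prod, Finset.prod_eq_zero this]

theorem prod_prod_erase_sub {R : Type*} [CommRing R] {n : ℕ} (r : Fin n → R) :
    ∏ i, ∏ j ∈ Finset.univ.erase i, (r i - r j) =
      (-1) ^ (n * (n - 1) / 2) * (∏ i, ∏ j ∈ Finset.Ioi i, (r j - r i)) ^ 2 := by
  have hcard : ∑ i : Fin n, (Finset.Ioi i).card = n * (n - 1) / 2 := by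
    simp_rw [Fin.card_Ioi]
    rw [Fin.sum_univ_eq_sum_range (fun i => n - 1 - i), Finset.sum_range_reflect (fun i => i),
      Finset.sum_range_id]
  have h := Finset.prod_prod_Ioi_mul_eq_prod_prod_off_diag (fun i j : Fin n => r j - r i)
  simp only [Finset.compl_eq_univ_sdiff, Finset.sdiff_singleton_eq_erase] at h
  rw [← h, ← hcard, ← Finset.prod_pow_eq_pow_sum, ← Finset.prod_pow, ← Finset.prod_mul_distrib]
  refine Finset.prod_congr rfl fun i _ => ?_
  rw [← Finset.prod_const, ← Finset.prod_pow, ← Finset.prod_mul_distrib]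
  exact Finset.prod_congr rfl fun j _ => by ring

/-- The discriminant `a^(2n-2) ∏_{i<j} (r_j - r_i)²` of a polynomial with leading coefficient `a`
and roots `r_i`, as a square. -/
theorem map_discr_eq_sq {k L : Type*} [Field k] [Field L] (φ : k →+* L) {f : k[X]} {n : ℕ}
    (hn : f.natDegree = n) (h0 : 0 < n) (r : Fin n → L)
    (hr : f.map φ = C (φ f.leadingCoeff) * ∏ i, (X - C (r i))) :
    φ f.discr = (φ f.leadingCoeff ^ (n - 1) * ∏ i, ∏ j ∈ Finset.Ioi i, (r j - r i)) ^ 2 := by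
  classical
  have hf0 : f ≠ 0 := by rintro rfl; simp at hn; omega
  set a := φ f.leadingCoeff with ha
  have ha0 : a ≠ 0 := by simpa [ha] using hf0
  have h1 := congrArg φ (resultant_deriv (f := f) (natDegree_pos_iff_degree_pos.1 (by omega)))
  rw [← resultant_map_map, ← derivative_map, hn] at h1
  have hroots : (f.map φ).roots = Finset.univ.val.map r := by
    rw [hr, roots_C_mul _ ha0, ← roots_multiset_prod_X_sub_C (Finset.univ.val.map r),
      Multiset.map_map]
    rfl
  have hdeg : (f.map φ).natDegree = n := by rw [natDegree_map, hn]
  have hs : (f.map φ).Splits := by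
    rw [splits_iff_card_roots, hroots, hdeg]; simp
  have h2 := resultant_eq_prod_eval (f.map φ) (f.map φ).derivative (n - 1)
    ((natDegree_derivative_le _).trans (by rw [hdeg])) hs
  rw [hdeg, leadingCoeff_map, ← ha, hroots, Multiset.map_map] at h2
  have h3 : (Finset.univ.val.map ((derivative (f.map φ)).eval ∘ r)).prod =
      a ^ n * ∏ i, ∏ j ∈ Finset.univ.erase i, (r i - r j) := by
    rw [Finset.prod_map_val]
    calc _ = ∏ i : Fin n, a * ∏ j ∈ Finset.univ.erase i, (r i - r j) := by
          refine Finset.prod_congr rfl fun i _ => ?_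
          rw [hr, Function.comp_apply, derivative_C_mul, eval_mul, eval_C,
            derivative_prod_X_sub_C_eval _ _ (Finset.mem_univ i)]
      _ = _ := by simp [Finset.prod_mul_distrib]
  rw [h2, h3, prod_prod_erase_sub, map_mul, map_mul, ← ha, map_pow, map_neg, map_one] at h1
  have hsgn : ((-1 : L) ^ (n * (n - 1) / 2)) ≠ 0 := pow_ne_zero _ (by simp)
  apply mul_left_cancel₀ (mul_ne_zero hsgn ha0)
  rw [← h1]
  obtain ⟨m, rfl⟩ : ∃ m, n = m + 1 := ⟨n - 1, by omega⟩
  rw [Nat.add_sub_cancel]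
  ring

end Polynomial

/-! ### Galois action on the roots -/

namespace EmbeddingProblem

section Roots

variable {k L : Type*} [Field k] [Field L] [Algebra k L] {n : ℕ} {f : k[X]}

theorem rootPerm_apply (e : Fin n ≃ f.rootSet L) (g : Gal(L/k)) (i : Fin n) :
    (e (rootPerm f e g i) : L) = g (e i) := by
  simp [rootPerm]

theorem rootPerm_injective [f.IsSplittingField k L] (e : Fin n ≃ f.rootSet L) :
    Function.Injective (rootPerm f e) := by
  intro g h hgh
  have hr : Set.EqOn g h (f.rootSet L) := fun x hx => by
    obtain ⟨i, hi⟩ := e.surjective ⟨x, hx⟩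
    have hi' : (e i : L) = x := congrArg Subtype.val hi
    rw [← hi', ← rootPerm_apply, hgh, rootPerm_apply]
  have : (g : L →ₐ[k] L) = h :=
    AlgHom.ext_of_adjoin_eq_top (IsSplittingField.adjoin_rootSet L f) hr
  exact AlgEquiv.ext fun x => DFunLike.congr_fun this x

theorem map_eq_prod_roots (hn : f.natDegree = n) (e : Fin n ≃ f.rootSet L) :
    f.map (algebraMap k L) =
      C (algebraMap k L f.leadingCoeff) * ∏ i, (X - C (e i : L)) := by
  have hle : Finset.univ.val.map (fun i => (e i : L)) ≤ (f.map (algebraMap k L)).roots := by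
    rw [Multiset.le_iff_subset]
    · intro x hx
      obtain ⟨i, -, rfl⟩ := Multiset.mem_map.1 hx
      have h := mem_rootSet'.1 (e i).2
      exact (mem_roots h.1).2 (by rw [IsRoot.def, eval_map_algebraMap, h.2])
    · exact Finset.univ.nodup.map (Subtype.val_injective.comp e.injective)
  have hcard : Multiset.card (f.map (algebraMap k L)).roots ≤ n :=
    (card_roots' _).trans (by rw [natDegree_map, hn])
  have heq := Multiset.eq_of_le_of_card_le hle (by simpa using hcard)
  have := C_leadingCoeff_mul_prod_multiset_X_sub_C (p := f.map (algebraMap k L))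
    (by rw [← heq, natDegree_map, hn]; simp)
  rw [← heq, leadingCoeff_map, Multiset.map_map] at this
  exact this.symm

/-- The square root of the discriminant given by the Vandermonde product of the roots. The Galois
group acts on it through the sign of the permutation of the roots. -/
theorem exists_sqrt_discr (hn : f.natDegree = n) (h0 : 0 < n) (e : Fin n ≃ f.rootSet L) :
    ∃ δ : L, δ ≠ 0 ∧ δ ^ 2 = algebraMap k L f.discr ∧
      ∀ g : Gal(L/k), g δ = ((Equiv.Perm.sign (rootPerm f e g) : ℤ) : L) * δ := by
  refine ⟨algebraMap k L f.leadingCoeff ^ (n - 1) *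
    ∏ i, ∏ j ∈ Finset.Ioi i, ((e j : L) - e i), ?_, ?_, fun g => ?_⟩
  · have hf0 : f ≠ 0 := by rintro rfl; simp at hn; omega
    refine mul_ne_zero (pow_ne_zero _ (by simpa using hf0)) ?_
    refine Finset.prod_ne_zero_iff.2 fun i _ => Finset.prod_ne_zero_iff.2 fun j hj => ?_
    rw [sub_ne_zero]
    exact fun h => (Finset.mem_Ioi.1 hj).ne' (e.injective (Subtype.ext h))
  · exact (map_discr_eq_sq (algebraMap k L) hn h0 _ (map_eq_prod_roots hn e)).symm
  · simp only [map_mul, map_pow, AlgEquiv.commutes, map_prod, map_sub, ← rootPerm_apply e g]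
    rw [Equiv.Perm.prod_Ioi_comp_eq_sign_mul_prod (rootPerm f e g)
      (f := fun i j => (e j : L) - e i) (fun i j => by ring)]
    ring

end Roots

/-! ### Square roots of characters with values in `±1` -/

/-- The element `1` or `J` as `a = 1` or `a = -1`. If `J² = -1`, this is a square root of `a`. -/
def signRoot {R : Type*} [One R] (J : R) (a : ℤˣ) : R := if a = 1 then 1 else J

/-- The bilinear symbol on `±1` that is `-1` only at `(-1, -1)`. -/
def signPairing (a b : ℤˣ) : ℤˣ := if a = 1 then 1 else b

theorem signRoot_one {R : Type*} [One R] (J : R) : signRoot J 1 = 1 := if_pos rfl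

theorem signRoot_neg_one {R : Type*} [One R] (J : R) : signRoot J (-1) = J := if_neg (by decide)

theorem signPairing_comm (a b : ℤˣ) : signPairing a b = signPairing b a := by
  revert a b; decide

theorem signPairing_one_left (b : ℤˣ) : signPairing 1 b = 1 := if_pos rfl

theorem signRoot_mul_signRoot {R : Type*} [Ring R] {J : R} (hJ : J * J = -1) (a b : ℤˣ) :
    signRoot J a * signRoot J b = ((signPairing a b : ℤ) : R) * signRoot J (a * b) := by
  rcases Int.units_eq_one_or a with rfl | rfl <;> rcases Int.units_eq_one_or b with rfl | rfl <;>
    simp [signRoot_one, signRoot_neg_one, signPairing, hJ]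

/-! ### Extensions that differ by a character -/

section Twist

variable {E₁ E₂ G : Type*} [Group E₁] [Group E₂] [Group G]

/-- The map `φ` identifies the extension `S₁` with `S₂` up to the `2`-cocycle
`(g, h) ↦ signPairing (χ g) (χ h)`. -/
structure IsSignTwist (χ : G →* ℤˣ) (S₁ : GroupExtension ℤˣ E₁ G) (S₂ : GroupExtension ℤˣ E₂ G)
    (φ : E₁ → E₂) : Prop where
  rightHom_apply : ∀ x, S₂.rightHom (φ x) = S₁.rightHom x
  inl_mul : ∀ a x, φ (S₁.inl a * x) = S₂.inl a * φ x
  mul : ∀ x y, φ x * φ y =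
    S₂.inl (signPairing (χ (S₁.rightHom x)) (χ (S₁.rightHom y))) * φ (x * y)

theorem exists_inl_mul_of_rightHom_eq (S : GroupExtension ℤˣ E₁ G) {x y : E₁}
    (h : S.rightHom x = S.rightHom y) : ∃ a, x = S.inl a * y := by
  have hk : x * y⁻¹ ∈ S.rightHom.ker := by
    rw [MonoidHom.mem_ker, map_mul, map_inv, h, mul_inv_cancel]
  rw [← S.range_inl_eq_ker_rightHom] at hk
  obtain ⟨a, ha⟩ := hk
  exact ⟨a, by rw [ha, inv_mul_cancel_right]⟩

namespace IsSignTwist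

variable {χ : G →* ℤˣ} {S₁ : GroupExtension ℤˣ E₁ G} {S₂ : GroupExtension ℤˣ E₂ G} {φ : E₁ → E₂}

theorem injective (h : IsSignTwist χ S₁ S₂ φ) : Function.Injective φ := by
  intro x y hxy
  obtain ⟨a, rfl⟩ := exists_inl_mul_of_rightHom_eq S₁ (x := x) (y := y)
    (by rw [← h.rightHom_apply, hxy, h.rightHom_apply])
  rw [h.inl_mul, mul_eq_right, map_eq_one_iff _ S₂.inl_injective] at hxy
  rw [hxy, map_one, one_mul]

theorem mul_of_even (h : IsSignTwist χ S₁ S₂ φ) {x : E₁} (hx : χ (S₁.rightHom x) = 1) (y : E₁) :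
    φ (x * y) = φ x * φ y := by
  rw [h.mul, hx, signPairing_one_left, map_one, one_mul]

theorem map_one (h : IsSignTwist χ S₁ S₂ φ) : φ 1 = 1 := by
  have := h.mul_of_even (x := 1) (by simp) 1
  rwa [mul_one, eq_comm, mul_eq_left] at this

/-- On the elements that lie over the kernel of `χ`, the map is a homomorphism. -/
def evenHom (h : IsSignTwist χ S₁ S₂ φ) : (χ.comp S₁.rightHom).ker →* E₂ where
  toFun x := φ x
  map_one' := h.map_one
  map_mul' x y := h.mul_of_even x.2 y

theorem zpow (h : IsSignTwist χ S₁ S₂ φ) {x : E₁} (hx : χ (S₁.rightHom x) = 1) (α : ℤ) :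
    φ (x ^ α) = φ x ^ α :=
  map_zpow h.evenHom (⟨x, hx⟩ : (χ.comp S₁.rightHom).ker) α

theorem freeGroup_lift (h : IsSignTwist χ S₁ S₂ φ) {ι : Type*} {x : ι → E₁}
    (hx : ∀ i, χ (S₁.rightHom (x i)) = 1) (w : FreeGroup ι) :
    φ (FreeGroup.lift x w) = FreeGroup.lift (fun i => φ (x i)) w := by
  let x' : ι → (χ.comp S₁.rightHom).ker := fun i => ⟨x i, hx i⟩
  have h1 : FreeGroup.lift x = (χ.comp S₁.rightHom).ker.subtype.comp (FreeGroup.lift x') := by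
    ext i; simp [x']
  have h2 : FreeGroup.lift (fun i => φ (x i)) = h.evenHom.comp (FreeGroup.lift x') := by
    ext i; simp [x', evenHom]
  rw [h1, h2]
  rfl

/-- The symbol `signPairing` is symmetric, so its values for `xy` and `yx` cancel in the
commutator. -/
theorem commutator (h : IsSignTwist χ S₁ S₂ φ) (x y : E₁) :
    φ (x * y * x⁻¹ * y⁻¹) = φ x * φ y * (φ x)⁻¹ * (φ y)⁻¹ := by
  have he : χ (S₁.rightHom (x * y * x⁻¹ * y⁻¹)) = 1 := by
    rw [map_mul, map_mul, map_mul, map_mul, map_mul, map_mul, map_inv, map_inv, map_inv, map_inv,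
      mul_comm (χ (S₁.rightHom x)), mul_inv_cancel_right, mul_inv_cancel]
  have h1 := h.mul_of_even he (y * x)
  rw [show x * y * x⁻¹ * y⁻¹ * (y * x) = x * y by group] at h1
  have h2 := h.mul x y
  have h3 := h.mul y x
  rw [h1, ← mul_assoc, ← inl_central, mul_assoc, signPairing_comm, ← h3] at h2
  rw [← mul_inv_eq_iff_eq_mul] at h2
  rw [← h2]
  group

/-- If `σ 0` is an involution with `χ (σ 0) = -1` whose preimages in `S₁` are involutions, and the
other `σ j` generate the kernel of `χ`, then `S₂` is the twist of `S₁` at `σ 0`. -/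
theorem isTwist (h : IsSignTwist χ S₁ S₂ φ) {m : ℕ} {σ : Fin (m + 1) → G}
    (hσ : χ (σ 0) = -1) (hker : Subgroup.closure (Set.range fun j : Fin m => σ j.succ) = χ.ker)
    (hsq : ∀ x, S₁.rightHom x = σ 0 → x ^ 2 = 1) : IsTwist 2 2 (-1 : ℤˣ) S₁ S₂ σ := by
  have hσ1 : σ 0 ≠ 1 := by
    intro h1
    rw [h1, _root_.map_one] at hσ
    exact absurd hσ (by decide)
  have heven (j : Fin m) : χ (σ j.succ) = 1 := by
    have : σ j.succ ∈ Subgroup.closure (Set.range fun j : Fin m => σ j.succ) :=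
      Subgroup.subset_closure ⟨j, rfl⟩
    rwa [hker] at this
  have horder : orderOf (σ 0) = 2 := by
    obtain ⟨x, hx⟩ := S₁.rightHom_surjective (σ 0)
    exact orderOf_eq_prime (by rw [← hx, ← map_pow, hsq x hx, _root_.map_one]) hσ1
  refine ⟨one_lt_two, ?_, ?_, by simpa using horder, ?_, ?_, ?_, ?_⟩
  · exact orderOf_eq_prime (by decide) (by decide)
  · rw [eq_top_iff]
    intro a _
    rcases Int.units_eq_one_or a with rfl | rfl
    exacts [one_mem _, Subgroup.mem_zpowers _]
  · rw [eq_top_iff]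
    have hle : χ.ker ≤ Subgroup.closure (Set.range σ) := by
      rw [← hker]
      exact Subgroup.closure_mono (by rintro _ ⟨j, rfl⟩; exact ⟨_, rfl⟩)
    intro g _
    rcases Int.units_eq_one_or (χ g) with hg | hg
    · exact hle hg
    · have h0 : σ 0 ∈ Subgroup.closure (Set.range σ) := Subgroup.subset_closure ⟨0, rfl⟩
      have : (σ 0)⁻¹ * g ∈ χ.ker := by
        rw [MonoidHom.mem_ker, map_mul, map_inv, hσ, hg, inv_mul_cancel]
      simpa using mul_mem h0 (hle this)
  · rw [hker]; infer_instance
  · intro i h1 h2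
    obtain rfl : i = 1 := by omega
    rw [pow_one, hker, MonoidHom.mem_ker, hσ]
    decide
  · intro x hx
    have hx1 (j : Fin m) : χ (S₁.rightHom (x j.succ)) = 1 := by rw [hx, heven]
    have hy : φ (x 0) ^ 2 = S₂.inl (-1) := by
      rw [sq, h.mul, hx, hσ, ← sq, hsq _ (hx 0), h.map_one, mul_one]
      rfl
    refine ⟨fun j => φ (x j), fun j => by rw [h.rightHom_apply, hx], ?_, ⟨-1, hy.symm⟩, ?_, ?_, ?_⟩
    · change orderOf (x 0) = 2
      refine orderOf_eq_prime (hsq _ (hx 0)) fun h1 => hσ1 ?_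
      rw [← hx, h1, _root_.map_one]
    · change φ (x 0) ^ 2 ≠ 1
      rw [hy, Ne, map_eq_one_iff _ S₂.inl_injective]
      decide
    · intro j α l w
      rw [← h.zpow (hx1 j), ← h.freeGroup_lift hx1, ← h.inl_mul, h.injective.eq_iff]
    · intro i j l w
      rw [← h.commutator, ← h.freeGroup_lift hx1, ← h.inl_mul, h.injective.eq_iff]

/-- The factor sets of arbitrary sections of the two extensions differ by
`(g, h) ↦ signPairing (χ g) (χ h)` up to the coboundary of a function `ε`. -/
theorem exists_factorSet (h : IsSignTwist χ S₁ S₂ φ) (s₁ : S₁.Section) (s₂ : S₂.Section) :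
    ∃ ε : G → ℤˣ, ∀ a b, ε a * ε b * signPairing (χ a) (χ b) * factorSet S₂ s₂ (a, b) =
      factorSet S₁ s₁ (a, b) * ε (a * b) := by
  have hε (g : G) : ∃ a, s₂ g = S₂.inl a * φ (s₁ g) :=
    exists_inl_mul_of_rightHom_eq S₂ (by rw [h.rightHom_apply]; simp)
  choose ε hε using hε
  refine ⟨ε, fun a b => ?_⟩
  suffices h0 : factorSet S₂ s₂ (a, b) * ε (a * b) =
      ε a * ε b * signPairing (χ a) (χ b) * factorSet S₁ s₁ (a, b) by
    -- every element of `ℤˣ` is its own inverse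
    rw [← eq_mul_inv_iff_mul_eq, Int.units_inv_eq_self] at h0
    rw [h0]
    generalize ε a * ε b * signPairing (χ a) (χ b) = t
    rw [mul_assoc, ← mul_assoc t, Int.units_mul_self, one_mul]
  refine S₂.inl_injective (mul_right_cancel (b := φ (s₁ (a * b))) ?_)
  have h1 := inl_factorSet S₁ s₁ a b
  have h2 := inl_factorSet S₂ s₂ a b
  have h3 := h.mul (s₁ a) (s₁ b)
  rw [← h1, h.inl_mul] at h3
  simp only [GroupExtension.Section.rightHom_section] at h3
  calc S₂.inl (factorSet S₂ s₂ (a, b) * ε (a * b)) * φ (s₁ (a * b))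
      = s₂ a * s₂ b := by rw [← h2, map_mul, mul_assoc, ← hε]
    _ = S₂.inl (ε a) * (φ (s₁ a) * S₂.inl (ε b)) * φ (s₁ b) := by
        rw [hε a, hε b]; simp only [mul_assoc]
    _ = S₂.inl (ε a) * S₂.inl (ε b) * (φ (s₁ a) * φ (s₁ b)) := by
        rw [inl_central]; simp only [mul_assoc]
    _ = _ := by rw [h3]; simp only [map_mul, mul_assoc]

theorem pullback {G' : Type*} [Group G'] (h : IsSignTwist χ S₁ S₂ φ) (ρ : G' →* G) :
    IsSignTwist (χ.comp ρ) (pullback S₁ ρ) (EmbeddingProblem.pullback S₂ ρ)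
      (fun x => ⟨(φ x.1.1, x.1.2), (h.rightHom_apply _).trans x.2⟩) where
  rightHom_apply _ := rfl
  inl_mul a x := by
    refine Subtype.ext (Prod.ext (h.inl_mul a x.1.1) rfl)
  mul x y := by
    refine Subtype.ext (Prod.ext ?_ (one_mul _).symm)
    refine (h.mul x.1.1 y.1.1).trans ?_
    have hx : S₁.rightHom x.1.1 = ρ x.1.2 := x.2
    have hy : S₁.rightHom y.1.1 = ρ y.1.2 := y.2
    rw [hx, hy]
    rfl

end IsSignTwist

end Twist

end EmbeddingProblem

/-! ### The positive and the negative double cover -/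

namespace DoubleCover

open CliffordAlgebra EmbeddingProblem

variable {n : ℕ}

theorem signRoot_I_mul_self (a : ℤˣ) :
    signRoot Complex.I a * signRoot Complex.I a = ((a : ℤ) : ℂ) := by
  rcases Int.units_eq_one_or a with rfl | rfl <;> simp [signRoot_one, signRoot_neg_one]

/-- The square root of the sign of a permutation as a complex unit: `1` or `√-1`. -/
noncomputable def signRootUnit (σ : Equiv.Perm (Fin n)) : ℂˣ :=
  Units.mk0 (signRoot Complex.I (Equiv.Perm.sign σ)) fun h => by
    have := signRoot_I_mul_self (Equiv.Perm.sign σ)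
    rw [h, mul_zero] at this
    exact Units.ne_zero (Equiv.Perm.sign σ) (by exact_mod_cast this.symm)

theorem IsPinLift.signRoot_smul {x : Cl n} {σ : Equiv.Perm (Fin n)} (hx : IsPinLift 1 x σ) :
    IsPinLift Equiv.Perm.sign (signRoot Complex.I (Equiv.Perm.sign σ) • x) σ where
  parity := by rw [map_smul, hx.parity, smul_comm]
  conj i := by rw [smul_mul_assoc, hx.conj, mul_smul_comm, smul_comm]
  norm := by
    rw [map_smul, smul_mul_smul_comm, hx.norm, signRoot_I_mul_self]
    rw [MonoidHom.one_apply, Units.val_one, Int.cast_one, map_one, Algebra.algebraMap_eq_smul_one]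

/-- The bijection from the positive to the negative double cover which multiplies the lifts of the
odd permutations by `√-1`. -/
noncomputable def posToNeg (x : PosGroup n) : NegGroup n :=
  ⟨(Units.map (algebraMap ℂ (Cl n)).toMonoidHom (signRootUnit x.1.2) * x.1.1, x.1.2), by
    have := IsPinLift.signRoot_smul x.2
    rw [Algebra.smul_def] at this
    exact this⟩

theorem isSignTwist_posToNeg :
    IsSignTwist Equiv.Perm.sign (pos n) (neg n) (posToNeg (n := n)) where
  rightHom_apply _ := rfl
  inl_mul a x := by
    refine Subtype.ext (Prod.ext (Units.ext ?_) rfl)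
    change algebraMap ℂ (Cl n) (signRoot Complex.I (Equiv.Perm.sign (1 * x.1.2))) *
      (((unitHom n a : (Cl n)ˣ) : Cl n) * x.1.1) = ((unitHom n a : (Cl n)ˣ) : Cl n) *
        (algebraMap ℂ (Cl n) (signRoot Complex.I (Equiv.Perm.sign x.1.2)) * x.1.1)
    rw [one_mul, ← mul_assoc, ← mul_assoc, Algebra.commutes]
  mul x y := by
    refine Subtype.ext (Prod.ext (Units.ext ?_) (one_mul _).symm)
    change algebraMap ℂ (Cl n) (signRoot Complex.I (Equiv.Perm.sign x.1.2)) * x.1.1 *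
        (algebraMap ℂ (Cl n) (signRoot Complex.I (Equiv.Perm.sign y.1.2)) * y.1.1) =
      ((unitHom n (signPairing (Equiv.Perm.sign x.1.2) (Equiv.Perm.sign y.1.2)) : (Cl n)ˣ) : Cl n) *
        (algebraMap ℂ (Cl n) (signRoot Complex.I (Equiv.Perm.sign (x.1.2 * y.1.2))) *
          (x.1.1 * y.1.1))
    have h := congrArg (algebraMap ℂ (Cl n)) (signRoot_mul_signRoot Complex.I_mul_I
      (Equiv.Perm.sign x.1.2) (Equiv.Perm.sign y.1.2))
    rw [map_mul, map_mul, map_intCast] at h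
    rw [mul_assoc, ← mul_assoc _ _ (y.1.1 : Cl n), ← Algebra.commutes, mul_assoc, ← mul_assoc, h,
      Equiv.Perm.sign_mul, mul_assoc]
    rfl

theorem sq_eq_one_of_isSwap {G : Type*} [Group G] {ρ : G →* Equiv.Perm (Fin n)}
    (hρ : Function.Injective ρ) (x : pullbackGroup (pos n) ρ)
    (hx : (ρ ((pullback (pos n) ρ).rightHom x)).IsSwap) :
    x ^ 2 = 1 := by
  obtain ⟨⟨y, g⟩, hy⟩ := x
  obtain ⟨i, j, hij, hg⟩ := hx
  change ρ g = Equiv.swap i j at hg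
  have h1 : y ^ 2 = 1 := by
    have := lift_swap_sq hij y (Eq.trans hy hg)
    rwa [MonoidHom.one_apply, map_one] at this
  have h2 : g ^ 2 = 1 := hρ (by rw [map_pow, hg, sq, Equiv.swap_mul_self, map_one])
  exact Subtype.ext (Prod.ext h1 h2)

end DoubleCover

namespace BrauerClass

/-! ### Homomorphisms out of crossed products -/

namespace CrossedProduct

variable {k L : Type u} [Field k] [Field L] [Algebra k L] [FiniteDimensional k L]
  {c : TwoCocycle k L}

/-- The homomorphism from a crossed product determined by a homomorphism on `L` and the images of
the `u_g`, which have to satisfy the defining relations. -/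
noncomputable def lift {B : Type*} [Ring B] [Algebra k B] (f : L →ₐ[k] B) (U : Gal(L/k) → B)
    (hone : U 1 = f (c.1 (1, 1))) (hcomm : ∀ g x, U g * f x = f (g x) * U g)
    (hmul : ∀ g h, U g * U h = f (c.1 (g, h)) * U (g * h)) : CrossedProduct c →ₐ[k] B :=
  have hs : ∀ g x, ∑ h, f ((single c g x).coord h) * U h = f x * U g := fun g x => by
    rw [Finset.sum_eq_single g (fun h _ hne => by rw [coord_single_ne hne, map_zero, zero_mul])
      (by simp), coord_single_same]
  AlgHom.ofLinearMap
    { toFun := fun a => ∑ g, f (a.coord g) * U g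
      map_add' := fun a b => by simp [add_mul, Finset.sum_add_distrib]
      map_smul' := fun r a => by simp [Finset.smul_sum] }
    (by
      change ∑ g, f ((1 : CrossedProduct c).coord g) * U g = 1
      rw [one_def, hs, hone, ← map_mul, Units.inv_mul, map_one])
    (by
      intro a b
      change ∑ g, f ((a * b).coord g) * U g = (∑ g, f (a.coord g) * U g) * ∑ g, f (b.coord g) * U g
      induction a using induction_on with
      | h0 => simp
      | ha a a' h h' => simp only [coord_add, map_add, add_mul, Finset.sum_add_distrib, h, h']
      | hs g x =>
        induction b using induction_on with
        | h0 => simp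
        | ha a a' h h' =>
          simp only [coord_add, map_add, add_mul, mul_add, Finset.sum_add_distrib, h, h']
        | hs h y =>
          rw [single_mul_single, hs, hs, hs, map_mul, map_mul, mul_assoc _ (f _) (U (g * h)),
            ← hmul, mul_assoc (f x), ← mul_assoc _ (U g), ← hcomm]
          simp only [mul_assoc])

/-- The embedding of `L` as a subfield of the crossed product. The unit element is
`c(1, 1)⁻¹ u_1`. -/
noncomputable def ofField (c : TwoCocycle k L) : L →ₐ[k] CrossedProduct c :=
  AlgHom.ofLinearMap
    { toFun := fun x => single c 1 (x * ((c.1 (1, 1))⁻¹ : Lˣ))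
      map_add' := fun x y => by rw [add_mul, single_add]
      map_smul' := fun r x => by
        ext g
        by_cases hg : g = 1
        · subst hg; simp [coord_single_same]
        · simp [coord_single_ne hg] }
    (by
      change single c 1 (1 * _) = _
      rw [one_mul, one_def])
    (by
      intro x y
      change single c 1 (x * y * _) = single c 1 (x * _) * single c 1 (y * _)
      rw [single_mul_single, AlgEquiv.one_apply, one_mul, mul_assoc (x * _),
        Units.inv_mul_cancel_right, mul_right_comm])

theorem ofField_apply (x : L) :
    ofField c x = single c 1 (x * ((c.1 (1, 1))⁻¹ : Lˣ)) := rfl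

theorem ofField_mul_single (x y : L) (g : Gal(L/k)) :
    ofField c x * single c g y = single c g (x * y) := by
  rw [ofField_apply, single_mul_single, one_mul, AlgEquiv.one_apply,
    groupCohomology.map_one_fst_of_isMulCocycle₂ c.2 g, mul_right_comm,
    Units.inv_mul_cancel_right]

theorem single_mul_ofField (x y : L) (g : Gal(L/k)) :
    single c g y * ofField c x = single c g (y * g x) := by
  rw [ofField_apply, single_mul_single, mul_one, map_mul,
    groupCohomology.map_one_snd_of_isMulCocycle₂ c.2 g]
  change single c g (y * (g x * g ((c.1 (1, 1))⁻¹ : Lˣ)) * g (c.1 (1, 1) : L)) = _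
  rw [mul_assoc, mul_assoc, ← map_mul, Units.inv_mul, map_one, mul_one]

theorem finrank_eq (c c' : TwoCocycle k L) :
    Module.finrank k (CrossedProduct c) = Module.finrank k (CrossedProduct c') :=
  LinearEquiv.finrank_eq
    { toFun := fun a => ⟨a.coord⟩
      invFun := fun a => ⟨a.coord⟩
      map_add' := fun _ _ => rfl
      map_smul' := fun _ _ => rfl
      left_inv := fun _ => rfl
      right_inv := fun _ => rfl }

end CrossedProduct

/-! ### Tensor product of a crossed product with a quaternion algebra -/

open EmbeddingProblem CrossedProduct

section

variable {k L : Type u} [Field k] [Field L] [Algebra k L] [FiniteDimensional k L]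

/-- A `2 × 2` matrix `J` with `J² = -1`. -/
def matJ (k : Type*) [Field k] : Matrix (Fin 2) (Fin 2) k := !![0, 1; -1, 0]

/-- A `2 × 2` matrix `K` with `K² = 1` and `KJ = -JK`. -/
def matK (k : Type*) [Field k] : Matrix (Fin 2) (Fin 2) k := !![1, 0; 0, -1]

theorem matJ_mul_self : matJ k * matJ k = -1 := by
  ext i j; fin_cases i <;> fin_cases j <;> simp [matJ]

theorem matK_mul_self : matK k * matK k = 1 := by
  ext i j; fin_cases i <;> fin_cases j <;> simp [matK]

theorem matK_mul_matJ : matK k * matJ k = -(matJ k * matK k) := by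
  ext i j; fin_cases i <;> fin_cases j <;> simp [matJ, matK]

theorem matK_mul_signRoot (a : ℤˣ) :
    matK k * signRoot (matJ k) a = (a : ℤ) • (signRoot (matJ k) a * matK k) := by
  rcases Int.units_eq_one_or a with rfl | rfl <;>
    simp [signRoot_one, signRoot_neg_one, matK_mul_matJ]

theorem matJ_mul_signRoot (a : ℤˣ) :
    matJ k * signRoot (matJ k) a = signRoot (matJ k) a * matJ k := by
  rcases Int.units_eq_one_or a with rfl | rfl <;> simp [signRoot_one, signRoot_neg_one]

/-- The quaternion algebra `(-1, d)` inside `A ⊗ M₂(k)`, for a crossed product `A` over a field that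
contains a square root `δ` of `d`: `i ↦ 1 ⊗ J` and `j ↦ δ ⊗ K`. -/
noncomputable def quaternionBasis (c : TwoCocycle k L) {d : k} {δ : L}
    (hδ : δ ^ 2 = algebraMap k L d) :
    QuaternionAlgebra.Basis (CrossedProduct c ⊗[k] Matrix (Fin 2) (Fin 2) k) (-1 : k) 0 d where
  i := 1 ⊗ₜ matJ k
  j := ofField c δ ⊗ₜ matK k
  k := ofField c δ ⊗ₜ (matJ k * matK k)
  i_mul_i := by
    simp [matJ_mul_self, Algebra.TensorProduct.one_def, TensorProduct.tmul_neg]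
  j_mul_j := by
    rw [Algebra.TensorProduct.tmul_mul_tmul, matK_mul_self, ← map_mul, ← sq, hδ, AlgHom.commutes,
      ← Algebra.TensorProduct.algebraMap_apply, Algebra.algebraMap_eq_smul_one]
  i_mul_j := by simp
  j_mul_i := by simp [matK_mul_matJ, TensorProduct.tmul_neg]

/-- The element of `A ⊗ M₂(k)` which corrects `u_g` by the matrix `1` or `J`, as `χ(g) = 1` or
`χ(g) = -1`, and by the sign `ε(g)`. These elements multiply with the factor set of `A`
multiplied by the `2`-cocycle `(g, h) ↦ signPairing (χ g) (χ h)` and the coboundary of `ε`. -/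
noncomputable def twistedBasis (c : TwoCocycle k L) (χ : Gal(L/k) →* ℤˣ) (ε : Gal(L/k) → ℤˣ)
    (g : Gal(L/k)) : CrossedProduct c ⊗[k] Matrix (Fin 2) (Fin 2) k :=
  single c g ((ε g : ℤ) : L) ⊗ₜ signRoot (matJ k) (χ g)

theorem single_intCast_mul (c : TwoCocycle k L) (g : Gal(L/k)) (a : ℤ) (x : L) :
    single c g ((a : L) * x) = a • single c g x := by
  ext h
  rw [coord_smul]
  by_cases hh : h = g
  · subst hh; simp [coord_single_same]
  · simp [coord_single_ne hh]

section TwistHom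

variable {c c' : TwoCocycle k L} {χ : Gal(L/k) →* ℤˣ} {ε : Gal(L/k) → ℤˣ}

/-- The embedding in `A' ⊗ M₂(k)` of the crossed product `A` whose cocycle differs from the one
of `A'` by `(g, h) ↦ signPairing (χ g) (χ h)` and the coboundary of `ε`. -/
noncomputable def twistHom
    (h : ∀ g h, ((ε g : ℤ) : L) * (ε h : ℤ) * (signPairing (χ g) (χ h) : ℤ) * c'.1 (g, h) =
      c.1 (g, h) * (ε (g * h) : ℤ)) :
    CrossedProduct c →ₐ[k] CrossedProduct c' ⊗[k] Matrix (Fin 2) (Fin 2) k :=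
  have hsq : ∀ a : ℤˣ, ((a : ℤ) : L) * (a : ℤ) = 1 := fun a => by
    rcases Int.units_eq_one_or a with rfl | rfl <;> simp
  lift (Algebra.TensorProduct.includeLeft.comp (ofField c')) (twistedBasis c' χ ε)
    (by
      have h1 := h 1 1
      rw [mul_one, map_one, signPairing_one_left, Units.val_one, Int.cast_one, mul_one, hsq,
        one_mul] at h1
      have h2 : (c.1 (1, 1) : L) = c'.1 (1, 1) * (ε 1 : ℤ) := by rw [h1, mul_assoc, hsq, mul_one]
      rw [twistedBasis, map_one, signRoot_one, AlgHom.comp_apply,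
        Algebra.TensorProduct.includeLeft_apply, ofField_apply, h2, mul_right_comm,
        Units.mul_inv, one_mul])
    (fun g x => by
      rw [twistedBasis, AlgHom.comp_apply, AlgHom.comp_apply,
        Algebra.TensorProduct.includeLeft_apply, Algebra.TensorProduct.includeLeft_apply,
        Algebra.TensorProduct.tmul_mul_tmul, Algebra.TensorProduct.tmul_mul_tmul, one_mul,
        mul_one, single_mul_ofField, ofField_mul_single, mul_comm])
    (fun g h' => by
      rw [twistedBasis, twistedBasis, twistedBasis, AlgHom.comp_apply,
        Algebra.TensorProduct.includeLeft_apply, Algebra.TensorProduct.tmul_mul_tmul,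
        Algebra.TensorProduct.tmul_mul_tmul, one_mul, single_mul_single, ofField_mul_single,
        signRoot_mul_signRoot matJ_mul_self, ← zsmul_eq_mul (signRoot _ _), TensorProduct.tmul_smul,
        TensorProduct.smul_tmul', ← single_intCast_mul, map_intCast, map_mul χ]
      congr 2
      linear_combination h g h')

theorem commute_quaternionBasis_twistHom {d : k} {δ : L} (hδ : δ ^ 2 = algebraMap k L d)
    (hχ : ∀ g : Gal(L/k), g δ = ((χ g : ℤ) : L) * δ)
    (h : ∀ g h, ((ε g : ℤ) : L) * (ε h : ℤ) * (signPairing (χ g) (χ h) : ℤ) * c'.1 (g, h) =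
      c.1 (g, h) * (ε (g * h) : ℤ))
    (q : QuaternionAlgebra k (-1 : k) 0 d) (a : CrossedProduct c) :
    Commute ((quaternionBasis c' hδ).liftHom q) (twistHom h a) := by
  have key : ∀ (g : Gal(L/k)) (x : L), Algebra.TensorProduct.includeLeft.comp (ofField c') x *
      twistedBasis c' χ ε g = single c' g (x * (ε g : ℤ)) ⊗ₜ signRoot (matJ k) (χ g) :=
    fun g x => by
    rw [twistedBasis, AlgHom.comp_apply, Algebra.TensorProduct.includeLeft_apply,
      Algebra.TensorProduct.tmul_mul_tmul, one_mul, ofField_mul_single]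
  have hi : Commute (quaternionBasis c' hδ).i (twistHom h a) := by
    refine Commute.sum_right _ _ _ fun g _ => ?_
    rw [key, commute_iff_eq]
    change (1 ⊗ₜ matJ k) * _ = _ * (1 ⊗ₜ matJ k)
    rw [Algebra.TensorProduct.tmul_mul_tmul, Algebra.TensorProduct.tmul_mul_tmul, one_mul, mul_one,
      matJ_mul_signRoot]
  have hj : Commute (quaternionBasis c' hδ).j (twistHom h a) := by
    refine Commute.sum_right _ _ _ fun g _ => ?_
    rw [key, commute_iff_eq]
    change (ofField c' δ ⊗ₜ matK k) * _ = _ * (ofField c' δ ⊗ₜ matK k)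
    rw [Algebra.TensorProduct.tmul_mul_tmul, Algebra.TensorProduct.tmul_mul_tmul,
      matK_mul_signRoot, ofField_mul_single, single_mul_ofField, hχ, TensorProduct.tmul_smul,
      TensorProduct.smul_tmul', ← single_intCast_mul]
    congr 2
    ring
  have hk : Commute (quaternionBasis c' hδ).k (twistHom h a) := by
    rw [← (quaternionBasis c' hδ).i_mul_j]
    exact hi.mul_left hj
  change Commute (algebraMap k _ q.re + q.imI • (quaternionBasis c' hδ).i +
    q.imJ • (quaternionBasis c' hδ).j + q.imK • (quaternionBasis c' hδ).k) _
  exact (((Algebra.commute_algebraMap_left _ _).add_left (hi.smul_left _)).add_left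
    (hj.smul_left _)).add_left (hk.smul_left _)

end TwistHom

/-- If the cocycles `c'` and `c` differ by `(g, h) ↦ signPairing (χ g) (χ h)` up to a coboundary,
where `χ` describes the Galois action on a square root of `d`, then the classes of their crossed
products differ by the quaternion class `(-1, d)`. -/
theorem crossedProductClass_eq_quaternionClass_mul [NeZero (2 : k)] [IsGalois k L]
    {c c' : TwoCocycle k L} {χ : Gal(L/k) →* ℤˣ} {ε : Gal(L/k) → ℤˣ} {d : kˣ} {δ : L}
    (hδ : δ ^ 2 = algebraMap k L d) (hχ : ∀ g : Gal(L/k), g δ = ((χ g : ℤ) : L) * δ)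
    (h : ∀ g h, ((ε g : ℤ) : L) * (ε h : ℤ) * (signPairing (χ g) (χ h) : ℤ) * c'.1 (g, h) =
      c.1 (g, h) * (ε (g * h) : ℤ)) :
    crossedProductClass c' = quaternionClass (-1) d * crossedProductClass c := by
  let Q := QuaternionAlgebra k ((-1 : kˣ) : k) 0 (d : k)
  let F : Q ⊗[k] CrossedProduct c →ₐ[k] CrossedProduct c' ⊗[k] Matrix (Fin 2) (Fin 2) k :=
    Algebra.TensorProduct.lift (quaternionBasis c' hδ).liftHom (twistHom h)
      (commute_quaternionBasis_twistHom hδ hχ h)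
  have : Algebra.IsCentral k Q := quaternion_isCentral (-1) d
  have : IsSimpleRing Q := quaternion_isSimple (-1) d
  have : IsSimpleRing (CrossedProduct c) := CrossedProduct.isSimple c
  have : IsSimpleRing (Q ⊗[k] CrossedProduct c) := isSimpleRing_tensor
  -- the source is simple and both sides have the same dimension
  have hinj : Function.Injective F := F.toRingHom.injective
  have hrank : Module.finrank k (Q ⊗[k] CrossedProduct c) =
      Module.finrank k (CrossedProduct c' ⊗[k] Matrix (Fin 2) (Fin 2) k) := by
    rw [Module.finrank_tensorProduct, Module.finrank_tensorProduct, Module.finrank_matrix,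
      QuaternionAlgebra.finrank_eq_four, CrossedProduct.finrank_eq c c', mul_comm]
    simp
  have hbij : Function.Bijective F :=
    ⟨hinj, (LinearMap.injective_iff_surjective_of_finrank_eq_finrank hrank
      (f := F.toLinearMap)).1 hinj⟩
  have hone : Function.Bijective (Matrix.scalarAlgHom (Fin 1) k (α := Q ⊗[k] CrossedProduct c)) :=
    ⟨fun x y hxy => Matrix.scalar_inj.1 hxy, fun M => ⟨M 0 0, by
      ext i j
      fin_cases i; fin_cases j
      simp⟩⟩
  refine Quotient.sound ⟨2, 1, two_ne_zero, one_ne_zero, ⟨?_⟩⟩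
  exact (matrixEquivTensor (Fin 2) k (CrossedProduct c')).trans <|
    (AlgEquiv.ofBijective F hbij).symm.trans (AlgEquiv.ofBijective _ hone)

end

end BrauerClass

/-! ### Comparison of the two embedding problems -/

theorem corollary5p2 {k L : Type u} [Field k] [NeZero (2 : k)] [Field L] [Algebra k L]
    [FiniteDimensional k L] [IsGalois k L] (f : k[X]) (hf : Irreducible f)
    [f.IsSplittingField k L] (n : ℕ) (hn : f.natDegree = n) (e : Fin n ≃ f.rootSet L)
    (hG : ∃ g : Gal(L/k), (EmbeddingProblem.rootPerm f e g).IsSwap) :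
    (∀ (m : ℕ) (σ : Fin (m + 1) → Gal(L/k)),
      (EmbeddingProblem.rootPerm f e (σ 0)).IsSwap →
      Subgroup.closure (Set.range fun j : Fin m => σ j.succ) =
        (alternatingGroup (Fin n)).comap (EmbeddingProblem.rootPerm f e) →
      EmbeddingProblem.IsTwist 2 2 (-1 : ℤˣ)
        (EmbeddingProblem.pullback (DoubleCover.pos n) (EmbeddingProblem.rootPerm f e))
        (EmbeddingProblem.pullback (DoubleCover.neg n) (EmbeddingProblem.rootPerm f e)) σ) ∧
    ∃ hd : f.discr ≠ 0,
      ∀ (sPos : (EmbeddingProblem.pullback (DoubleCover.pos n)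
          (EmbeddingProblem.rootPerm f e)).Section)
        (sNeg : (EmbeddingProblem.pullback (DoubleCover.neg n)
          (EmbeddingProblem.rootPerm f e)).Section),
        EmbeddingProblem.obstruction (EmbeddingProblem.pullback (DoubleCover.neg n)
            (EmbeddingProblem.rootPerm f e)) sNeg =
          BrauerClass.quaternionClass (-1 : kˣ) (Units.mk0 f.discr hd) *
            EmbeddingProblem.obstruction (EmbeddingProblem.pullback (DoubleCover.pos n)
              (EmbeddingProblem.rootPerm f e)) sPos := by
  have htwist := DoubleCover.isSignTwist_posToNeg.pullback (EmbeddingProblem.rootPerm f e)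
  refine ⟨fun m σ hσ hker => htwist.isTwist ?_ hker fun x hx => ?_, ?_⟩
  · obtain ⟨i, j, hij, h⟩ := hσ
    rw [MonoidHom.comp_apply, h, Equiv.Perm.sign_swap hij]
  · exact DoubleCover.sq_eq_one_of_isSwap (EmbeddingProblem.rootPerm_injective e) x (by rwa [hx])
  · have h0 : 0 < n := by
      obtain ⟨-, i, -⟩ := hG
      exact i.pos
    obtain ⟨δ, hδ0, hδ, hχ⟩ := EmbeddingProblem.exists_sqrt_discr hn h0 e
    have hd : f.discr ≠ 0 := fun h => hδ0 (by simpa [h] using hδ)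
    refine ⟨hd, fun sPos sNeg => ?_⟩
    obtain ⟨ε, hε⟩ := htwist.exists_factorSet sPos sNeg
    refine BrauerClass.crossedProductClass_eq_quaternionClass_mul (d := Units.mk0 f.discr hd)
      (χ := Equiv.Perm.sign.comp (EmbeddingProblem.rootPerm f e)) (ε := ε) hδ hχ fun g h => ?_
    have := congrArg (fun a : ℤˣ => ((a : ℤ) : L)) (hε g h)
    simp only [Units.val_mul, Int.cast_mul] at this
    exact this
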